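/- Let $\Omega\subseteq[0,1]^d$ be a measurable set of positive Lebesgue measure and let $\mathcal P_X$ be the uniform distribution on $\Omega$. In the repeated-measurements model one observes $(X_{ij},Y_{ij})$, $1\le i\le n$, $1\le j\le m$, with $$Y_{ij}=Z_i(X_{ij})+\epsilon_{ij}=f^\circ(X_{ij})+U_i(X_{ij})+\epsilon_{ij},$$ where $Z_1,\dots,Z_n$ are i.i.d. copies of a random function $Z$ on $\Omega$, $f^\circ(x)=\mathbb E[Z(x)]$, $U_i=Z_i-f^\circ$, the $X_{ij}$ are i.i.d. from $\mathcal P_X$, the noise variables $\epsilon_{ij}$ are i.i.d. and centred, and the $Z_i$, $X_{ij}$, $\epsilon_{ij}$ are independent. The mean squared prediction error of an estimator $\tilde f$ is $\mathcal E_{f^\circ}(\tilde f)=\mathbb E\big[\int_\Omega(\tilde f-f^\circ)^2\,d\mathcal P_X\big]$. For $s>0$ let $\lfloor s\rfloor$ be the largest integer strictly smaller than $s$, and for $g:\mathbb R^K\to\mathbb R$ of class $C^{\lfloor s\rfloor}$ let $$\|g\|_{\mathcal C^s}=\sum_{|\alpha|<s}\|\partial^\alpha g\|_\infty+\sum_{|\alpha|=\lfloor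 s\rfloor}\sup_{x\ne x'}\frac{|\partial^\alpha g(x)-\partial^\alpha g(x')|}{\|x-x'\|^{s-\lfloor s\rfloor}}.$$ Let $\mathcal G$ be a finite rooted tree whose nodes carry labels $(s,K)$ with $s>0$ and $K\in\{1,2,\dots\}$; it is either a single node $(s,K)$, or a root $(s,K)$ with $K$ subtrees $\mathcal G_1,\dots,\mathcal G_K$. Fix $M>0$. The hierarchical composition model $\mathcal H^{\mathcal G}(\Omega)$ is the set of all $f:\Omega\to\mathbb R$ of the form $f(x)=g(x_{\pi(1)},\dots,x_{\pi(K)})$ with $\pi:\{1,\dots,K\}\to\{1,\dots,d\}$ if $\mathcal G$ is a single node, and $f(x)=g(h_1(x),\dots,h_K(x))$ with $h_k\in\mathcal H^{\mathcal G_k}(\Omega)$ otherwise, where in both cases $g:\mathbb R^K\to\mathbb R$ satisfies $\|g\|_{\mathcal C^s}\le M$. The intrinsic smoothness-dimension ratio of $\mathcal G$ is $\gamma=s/K$ for a single node and $\gamma=\min\big(s/K,\min_{1\le k\le K}\gamma_k\min(1,s)\big)$ otherwise, where $\gamma_k$ is the ratio of $\mathcal G_k$. The effective smoothness of a node $G=(s_G,K_G)$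 is $s_G^*=s_G\prod_{(s',K')}\min(1,s')$, where the product is over the proper ancestors of $G$. Let $b_2,b_3>0$. Assume that some node $G$ of $\mathcal G$ satisfies $s_G^*/K_G=\gamma$ and $K_G\le d$. Then there is a constant $c>0$, not depending on $n$ and $m$, such that for all $n,m$ with $nm\ge3$ $$\inf_{\tilde f}\ \sup\ \mathcal E_{f^\circ}(\tilde f)\ \ge\ c\,\big(n^{-1}+(nm)^{-2\gamma/(2\gamma+1)}\big),$$ where the infimum is over all (measurable) estimators based on the data $\{(X_{ij},Y_{ij})\}$, and the supremum is over all distributions of $(Z,\epsilon)$ for which $U=Z-f^\circ$ has continuous paths, $\mathbb E\exp(|U(X)|/b_2)\le2$ for $X\sim\mathcal P_X$ independent of $U$, $\mathbb E\exp(|\epsilon|/b_3)\le2$, and $f^\circ\in\mathcal H^{\mathcal G}(\Omega)$. -/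

import Mathlib

open MeasureTheory
open scoped ENNReal

noncomputable section

/-! ### Hölder balls on `ℝ^K` -/

/-- The largest integer strictly smaller than `s` (for `s > 0`). -/
def strictFloor (s : ℝ) : ℕ := ⌈s⌉₊ - 1

/-- The partial derivative of `g` in the `i`-th coordinate. -/
def partialDeriv {K : ℕ} (i : Fin K) (g : EuclideanSpace ℝ (Fin K) → ℝ) :
    EuclideanSpace ℝ (Fin K) → ℝ :=
  fun x => fderiv ℝ g x (EuclideanSpace.single i 1)

/-- `∂^α g = ∂₁^{α₁} ⋯ ∂_K^{α_K} g` for a multi-index `α`. -/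
def multiDeriv {K : ℕ} (α : Fin K → ℕ) (g : EuclideanSpace ℝ (Fin K) → ℝ) :
    EuclideanSpace ℝ (Fin K) → ℝ :=
  (List.finRange K).foldr (fun i h => (partialDeriv i)^[α i] h) g

/-- The supremum norm of `g` on `ℝ^K`, in `[0, ∞]`. -/
def supENorm {K : ℕ} (g : EuclideanSpace ℝ (Fin K) → ℝ) : ℝ≥0∞ :=
  ⨆ x, ENNReal.ofReal |g x|

/-- The Hölder seminorm with exponent `r`, in `[0, ∞]`. -/
def holderSeminorm {K : ℕ} (r : ℝ) (g : EuclideanSpace ℝ (Fin K) → ℝ) : ℝ≥0∞ :=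
  ⨆ (x) (x') (_ : x ≠ x'), ENNReal.ofReal (|g x - g x'| / ‖x - x'‖ ^ r)

/-- The `s`-Hölder norm: the sum of `‖∂^α g‖_∞` over all multi-indices with `|α| < s`, that is
`|α| ≤ strictFloor s`, plus the sum over `|α| = strictFloor s` of the Hölder seminorms of `∂^α g`
with exponent `s - strictFloor s`. It is meaningful for `g` of class `C^{strictFloor s}`. -/
def holderENorm {K : ℕ} (s : ℝ) (g : EuclideanSpace ℝ (Fin K) → ℝ) : ℝ≥0∞ :=
  (∑ j ∈ Finset.range (strictFloor s + 1),
      ∑ α ∈ Finset.piAntidiag (Finset.univ : Finset (Fin K)) j, supENorm (multiDeriv α g)) +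
    ∑ α ∈ Finset.piAntidiag (Finset.univ : Finset (Fin K)) (strictFloor s),
      holderSeminorm (s - strictFloor s) (multiDeriv α g)

/-- The functions `g : ℝ^K → ℝ` with `‖g‖_{C^s} ≤ M`. -/
def holderBall (K : ℕ) (s M : ℝ) : Set (EuclideanSpace ℝ (Fin K) → ℝ) :=
  {g | ContDiff ℝ (strictFloor s) g ∧ holderENorm s g ≤ ENNReal.ofReal M}

/-! ### Smoothness-dimension trees and the hierarchical composition model -/

/-- A finite rooted tree with nodes labelled by pairs `(s, K)`: a tree of height one is the single
node `(s, K)`; a higher tree is a root `(s, K)` with `K` subtrees, possibly of different heights. -/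
inductive SDTree : Type
  | leaf (s : ℝ) (K : ℕ) : SDTree
  | node (s : ℝ) (K : ℕ) (sub : Fin K → SDTree) : SDTree

namespace SDTree

/-- The smoothness label of the root. -/
def rootSmoothness : SDTree → ℝ
  | leaf s _ => s
  | node s _ _ => s

/-- The dimension label of the root. -/
def rootDim : SDTree → ℕ
  | leaf _ K => K
  | node _ K _ => K

/-- All labels satisfy `s > 0` and `K ≥ 1`. -/
def Admissible : SDTree → Prop
  | leaf s K => 0 < s ∧ 1 ≤ K
  | node s K sub => 0 < s ∧ 1 ≤ K ∧ ∀ k, (sub k).Admissible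

/-- The intrinsic smoothness-dimension ratio `γ`. -/
def intrinsicRatio : SDTree → ℝ
  | leaf s K => s / K
  | node s K sub => min (s / K) (⨅ k, (sub k).intrinsicRatio * min 1 s)

/-- The nodes of a tree: the root, or a node of one of the subtrees. -/
inductive Node : SDTree → Type
  | root (t : SDTree) : Node t
  | child {s : ℝ} {K : ℕ} {sub : Fin K → SDTree} (k : Fin K) (G : Node (sub k)) :
      Node (node s K sub)

/-- The smoothness label `s_G` of a node. -/
def Node.smoothness : {t : SDTree} → Node t → ℝ
  | _, Node.root t => t.rootSmoothness
  | _, Node.child _ G => G.smoothness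

/-- The dimension label `K_G` of a node. -/
def Node.dim : {t : SDTree} → Node t → ℕ
  | _, Node.root t => t.rootDim
  | _, Node.child _ G => G.dim

/-- The product of `min(1, s')` over the (proper) ancestors `(s', K')` of a node. -/
def Node.ancestorFactor : {t : SDTree} → Node t → ℝ
  | _, Node.root _ => 1
  | _, Node.child (s := s) _ G => min 1 s * G.ancestorFactor

/-- The effective smoothness index `s_G^*` of a node. -/
def Node.effectiveSmoothness {t : SDTree} (G : Node t) : ℝ :=
  G.smoothness * G.ancestorFactor

/-- The hierarchical composition model on `Ω ⊆ ℝ^d` given by a tree and the radius `M`. Its height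
parameter is the height of the tree. -/
def hierarchicalClass {d : ℕ} (M : ℝ) (Ω : Set (EuclideanSpace ℝ (Fin d))) :
    SDTree → Set (Ω → ℝ)
  | leaf s K => {f | ∃ g ∈ holderBall K s M, ∃ π : Fin K → Fin d,
      ∀ x : Ω, f x = g (WithLp.toLp 2 fun k => x.1 (π k))}
  | node s K sub => {f | ∃ g ∈ holderBall K s M, ∃ h : Fin K → Ω → ℝ,
      (∀ k, h k ∈ (sub k).hierarchicalClass M Ω) ∧
      ∀ x : Ω, f x = g (WithLp.toLp 2 fun k => h k x)}

end SDTree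

/-! ### The repeated measurements model -/

/-- The uniform distribution on `Ω`. -/
def uniformLaw {d : ℕ} (Ω : Set (EuclideanSpace ℝ (Fin d))) : Measure Ω :=
  (ProbabilityTheory.cond volume Ω).comap Subtype.val

/-- A joint distribution of the random function `Z` on `Ω` and of the noise: a random function `Z`
on some probability space, with finite expectation at each point, and, independent of it,
a centred noise law. -/
structure RandomFunctionModel {d : ℕ} (Ω : Set (EuclideanSpace ℝ (Fin d))) where
  /-- the probability space that carries `Z` -/
  S : Type
  [measurableSpace : MeasurableSpace S]
  /-- the probability measure on it -/
  P : Measure S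
  [isProb : IsProbabilityMeasure P]
  /-- the random function -/
  Z : S → Ω → ℝ
  measurable_Z : ∀ x, Measurable fun s => Z s x
  integrable_Z : ∀ x, Integrable (fun s => Z s x) P
  /-- the law of the noise variables -/
  noise : Measure ℝ
  [isProb_noise : IsProbabilityMeasure noise]
  integrable_noise : Integrable (fun e => e) noise
  noise_mean : ∫ e, e ∂noise = 0

namespace RandomFunctionModel

attribute [instance] RandomFunctionModel.measurableSpace RandomFunctionModel.isProb
  RandomFunctionModel.isProb_noise

variable {d : ℕ} {Ω : Set (EuclideanSpace ℝ (Fin d))}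

/-- The regression (mean) function `f°(x) = E[Z(x)]`. -/
def mean (𝓜 : RandomFunctionModel Ω) (x : Ω) : ℝ := ∫ s, 𝓜.Z s x ∂𝓜.P

/-- The individual stochastic part `U = Z - f°`. -/
def U (𝓜 : RandomFunctionModel Ω) (s : 𝓜.S) (x : Ω) : ℝ := 𝓜.Z s x - 𝓜.mean x

/-- `U` has continuous paths, and `U(X)`, for `X` with law `μX` independent of `U`, and the noise
are sub-exponential with parameters `b₂`, `b₃`. -/
def SubExponential (𝓜 : RandomFunctionModel Ω) (μX : Measure Ω) (b₂ b₃ : ℝ) : Prop :=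
  (∀ s, Continuous (𝓜.U s)) ∧
  ∫⁻ p : 𝓜.S × Ω, ENNReal.ofReal (Real.exp |𝓜.U p.1 p.2 / b₂|) ∂(𝓜.P.prod μX) ≤ 2 ∧
  ∫⁻ e, ENNReal.ofReal (Real.exp |e / b₃|) ∂𝓜.noise ≤ 2

/-- The sample space of the experiment: `n` subjects, design points, and noise variables. -/
abbrev Sample (𝓜 : RandomFunctionModel Ω) (n m : ℕ) : Type :=
  (Fin n → 𝓜.S) × (Fin n → Fin m → Ω) × (Fin n → Fin m → ℝ)

/-- The law of the experiment: i.i.d. subjects, i.i.d. design points with law `μX`,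
i.i.d. noise variables, all independent. -/
def sampleLaw (𝓜 : RandomFunctionModel Ω) (μX : Measure Ω) (n m : ℕ) :
    Measure (𝓜.Sample n m) :=
  (Measure.pi fun _ : Fin n => 𝓜.P).prod
    ((Measure.pi fun _ : Fin n => Measure.pi fun _ : Fin m => μX).prod
      (Measure.pi fun _ : Fin n => Measure.pi fun _ : Fin m => 𝓜.noise))

/-- The observed data `(X_ij, Y_ij)` with `Y_ij = Z_i(X_ij) + ε_ij`. -/
def data (𝓜 : RandomFunctionModel Ω) {n m : ℕ} (ω : 𝓜.Sample n m) :
    Fin n → Fin m → Ω × ℝ :=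
  fun i j => (ω.2.1 i j, 𝓜.Z (ω.1 i) (ω.2.1 i j) + ω.2.2 i j)

/-- The mean squared prediction error `E[∫ (T(data)(x) - f°(x))² dμX(x)]` of an estimator `T`. -/
def predictionError (𝓜 : RandomFunctionModel Ω) (μX : Measure Ω) (n m : ℕ)
    (T : (Fin n → Fin m → Ω × ℝ) → Ω → ℝ) : ℝ≥0∞ :=
  ∫⁻ ω, ∫⁻ x, ENNReal.ofReal ((T (𝓜.data ω) x - 𝓜.mean x) ^ 2) ∂μX ∂(𝓜.sampleLaw μX n m)

end RandomFunctionModel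

/-- The minimax prediction error: infimum over all (jointly measurable) estimators based on the
data, supremum over all distributions of `Z` and the noise that are sub-exponential with parameters
`b₂`, `b₃` and whose regression function lies in the class `F`. -/
def minimaxError {d : ℕ} {Ω : Set (EuclideanSpace ℝ (Fin d))} (μX : Measure Ω) (b₂ b₃ : ℝ)
    (F : Set (Ω → ℝ)) (n m : ℕ) : ℝ≥0∞ :=
  ⨅ (T : (Fin n → Fin m → Ω × ℝ) → Ω → ℝ) (_ : Measurable (Function.uncurry T)),
    ⨆ (𝓜 : RandomFunctionModel Ω) (_ : 𝓜.SubExponential μX b₂ b₃) (_ : 𝓜.mean ∈ F),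
      𝓜.predictionError μX n m T

end

/-! The sum of the two rates is at most twice the larger one, so each rate can be proved separately,
with its own family of models.

For $n^{-1}$, let $Z$ be a random constant with law $N(a,v)$ and let there be no noise. However
large $m$ is, a subject reveals a single Gaussian value, and two means at distance of order
$n^{-1/2}$ cannot be told apart from $n$ such values. Small constants belong to the hierarchical
class (`SDTree.exists_const_mem`), which gives `exists_inv_le_minimaxError`.

For the nonparametric rate, let $Z=f$ be deterministic and the noise Gaussian, so that there are
$nm$ ordinary regression observations. Let $G$ be the node with $s_G^*/K_G=\gamma$, and write $s,K$
for its labels and $\alpha$ for the product of $\min(1,s')$ over its ancestors. At $G$ put a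
function of size $h^s$ that is a sum of bumps of width $h$, switched on or off by bits. Below $G$,
use multiples of coordinates; above it, use multiples of $y\mapsto y^{\min(1,s')}$, which lie in the
Hölder balls because for $s'<1$ a clipped power is $s'$-Hölder. The composition has the form $F(g)$
with $F(y)=cy^\alpha$ on $[0,1]$ (`SDTree.Node.exists_lift`). The powers turn the amplitude $h^s$
into $h^{s\alpha}=h^{s_G^*}$ while leaving the width $h$ unchanged.

Flipping one bit thus changes $f$ by at most a multiple of $h^{s_G^*}$, on a set of mass at most a
multiple of $h^K$. The two laws still overlap when $nm\,h^{2s_G^*+K}$ is small, and Assouad's lemma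
(`exists_le_squared_error`) makes the error of order $h^{2s_G^*}$. With $h=(c/(nm))^{1/(2s_G^*+K)}$
this is $(nm)^{-2\gamma/(2\gamma+1)}$.

Since $\Omega$ is only measurable, a fixed grid might have its bumps mostly outside $\Omega$. The
plateaus of the $2^K$ half-cell translates of the grid cover everything, so one translate has
plateaus of mass at least $2^{-K}$. The condition $K\le d$ allows $K$ distinct coordinates, so that
a cell has volume of order $h^K$. -/

noncomputable section

/-! ### Smooth functions with prescribed derivative bounds -/

open scoped ContDiff

/-- `g` is smooth, and its `n`-th derivative is bounded by `C n` for every `n`. -/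
structure HasDerivBounds {E : Type*} [NormedAddCommGroup E] [NormedSpace ℝ E]
    (C : ℕ → ℝ) (g : E → ℝ) : Prop where
  contDiff : ContDiff ℝ ∞ g
  bound : ∀ n x, ‖iteratedFDeriv ℝ n g x‖ ≤ C n

section HasDerivBounds

variable {E : Type*} [NormedAddCommGroup E] [NormedSpace ℝ E] {C : ℕ → ℝ} {g : E → ℝ}

theorem HasDerivBounds.abs_le (hg : HasDerivBounds C g) (x : E) : |g x| ≤ C 0 := by
  simpa using hg.bound 0 x

theorem HasDerivBounds.norm_sub_le (hg : HasDerivBounds C g) (x y : E) :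
    |g x - g y| ≤ C 1 * ‖x - y‖ := by
  have h := Convex.norm_image_sub_le_of_norm_fderiv_le (𝕜 := ℝ) (f := g) (C := C 1) (s := Set.univ)
    (x := y) (y := x) (fun z _ => (hg.contDiff.differentiable (by simp)).differentiableAt)
    (fun z _ => by rw [← norm_iteratedFDeriv_one]; exact hg.bound 1 z) convex_univ trivial trivial
  simpa using h

theorem HasDerivBounds.nonneg (hg : HasDerivBounds C g) (n : ℕ) : 0 ≤ C n :=
  (norm_nonneg _).trans (hg.bound n 0)

theorem HasDerivBounds.comp_clm {F : Type*} [NormedAddCommGroup F] [NormedSpace ℝ F]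
    (hg : HasDerivBounds C g) (L : F →L[ℝ] E) (hL : ‖L‖ ≤ 1) :
    HasDerivBounds C (g ∘ L) := by
  refine ⟨hg.contDiff.comp L.contDiff, fun n x => ?_⟩
  rw [L.iteratedFDeriv_comp_right hg.contDiff x (i := n) (by exact_mod_cast le_top)]
  refine (ContinuousMultilinearMap.norm_compContinuousLinearMap_le _ _).trans ?_
  calc _ ≤ C n * 1 := by
        gcongr
        · exact hg.nonneg n
        · exact hg.bound n _
        · simpa using pow_le_one₀ (norm_nonneg _) hL
    _ = C n := mul_one _

theorem exists_hasDerivBounds_of_hasCompactSupport (hg : ContDiff ℝ ∞ g)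
    (hs : HasCompactSupport g) : ∃ C, HasDerivBounds C g := by
  have h : ∀ n : ℕ, ∃ C, ∀ x, ‖iteratedFDeriv ℝ n g x‖ ≤ C := fun n =>
    (hs.iteratedFDeriv n).exists_bound_of_continuous
      (hg.continuous_iteratedFDeriv (m := n) (by exact_mod_cast le_top))
  choose C hC using h
  exact ⟨C, hg, hC⟩

end HasDerivBounds

/-! ### Membership in Hölder balls -/

section Holder

variable {K : ℕ}

theorem HasDerivBounds.partialDeriv {C : ℕ → ℝ} {g : EuclideanSpace ℝ (Fin K) → ℝ}
    (hg : HasDerivBounds C g) (i : Fin K) :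
    HasDerivBounds (fun n => C (n + 1)) (partialDeriv i g) := by
  have hd : ContDiff ℝ ∞ (fderiv ℝ g) := hg.contDiff.fderiv_right (by simp)
  refine ⟨hd.clm_apply contDiff_const, fun n x => ?_⟩
  refine (norm_iteratedFDeriv_clm_apply_const (hd.contDiffAt (x := x)) (N := ∞)
    (by exact_mod_cast le_top)).trans ?_
  rw [norm_iteratedFDeriv_fderiv]
  simpa using hg.bound (n + 1) x

theorem HasDerivBounds.multiDeriv {C : ℕ → ℝ} {g : EuclideanSpace ℝ (Fin K) → ℝ}
    (hg : HasDerivBounds C g) (α : Fin K → ℕ) :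
    HasDerivBounds (fun n => C (n + ∑ i, α i)) (multiDeriv α g) := by
  have iter : ∀ (i : Fin K) (k : ℕ) (C : ℕ → ℝ) (g : EuclideanSpace ℝ (Fin K) → ℝ),
      HasDerivBounds C g → HasDerivBounds (fun n => C (n + k)) ((_root_.partialDeriv i)^[k] g) := by
    intro i k
    induction k with
    | zero => intro C g hg; simpa using hg
    | succ k ih =>
      intro C g hg
      have := ih _ _ (hg.partialDeriv i)
      simpa [Function.iterate_succ_apply, add_assoc, add_comm, add_left_comm] using this
  rw [Fin.sum_univ_def]
  unfold _root_.multiDeriv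
  induction List.finRange K with
  | nil => simpa using hg
  | cons i l ih =>
    have := iter i (α i) _ _ ih
    simpa [add_assoc] using this

theorem partialDeriv_scale (i : Fin K) (c b : ℝ) (g : EuclideanSpace ℝ (Fin K) → ℝ) :
    partialDeriv i (fun y => c * g (b • y)) = fun y => (c * b) * partialDeriv i g (b • y) := by
  funext y
  unfold partialDeriv
  have h1 : (fun y => c * g (b • y)) = c • (fun y => g (b • y)) := rfl
  have h2 : fderiv ℝ (fun y => g (b • y)) y = b • fderiv ℝ g (b • y) := fderiv_comp_smul b
  rw [h1, fderiv_const_smul_field, Pi.smul_apply, h2]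
  simp [mul_assoc]

theorem multiDeriv_scale (α : Fin K → ℕ) (c b : ℝ) (g : EuclideanSpace ℝ (Fin K) → ℝ) :
    multiDeriv α (fun y => c * g (b • y)) =
      fun y => (c * b ^ (∑ i, α i)) * multiDeriv α g (b • y) := by
  have iter : ∀ (i : Fin K) (k : ℕ) (c : ℝ) (g : EuclideanSpace ℝ (Fin K) → ℝ),
      (partialDeriv i)^[k] (fun y => c * g (b • y)) =
        fun y => (c * b ^ k) * (partialDeriv i)^[k] g (b • y) := by
    intro i k
    induction k with
    | zero => intro c g; simp
    | succ k ih =>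
      intro c g
      rw [Function.iterate_succ_apply, partialDeriv_scale, ih]
      funext y
      rw [Function.iterate_succ_apply]
      ring
  rw [Fin.sum_univ_def]
  unfold multiDeriv
  induction List.finRange K with
  | nil => simp
  | cons i l ih =>
    rw [List.foldr_cons, ih, iter]
    funext y
    simp only [List.foldr_cons, List.map_cons, List.sum_cons]
    ring

theorem strictFloor_lt {s : ℝ} (hs : 0 < s) : (strictFloor s : ℝ) < s := by
  have h : 0 < ⌈s⌉₊ := Nat.ceil_pos.2 hs
  exact Nat.lt_ceil.1 (by unfold strictFloor; omega)

theorem le_strictFloor_add_one (s : ℝ) : s ≤ strictFloor s + 1 := by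
  have h : s ≤ ⌈s⌉₊ := Nat.le_ceil s
  have h2 : (⌈s⌉₊ : ℝ) ≤ ((strictFloor s + 1 : ℕ) : ℝ) := by
    exact_mod_cast (by unfold strictFloor; omega)
  push_cast at h2
  linarith

/-- The number of summands in the `s`-Hölder norm on `ℝ^K`. -/
def holderTermCount (K : ℕ) (s : ℝ) : ℕ :=
  ∑ j ∈ Finset.range (strictFloor s + 1),
      (Finset.piAntidiag (Finset.univ : Finset (Fin K)) j).card +
    (Finset.piAntidiag (Finset.univ : Finset (Fin K)) (strictFloor s)).card

/-- The number of summands depends only on $K$ and $s$. Any uniform bound can therefore be brought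
below $M$ by multiplying the function by a small constant. -/
theorem holderENorm_le_of_bounds {s δ : ℝ} {g : EuclideanSpace ℝ (Fin K) → ℝ}
    (h1 : ∀ α : Fin K → ℕ, ∑ i, α i ≤ strictFloor s → ∀ x, |multiDeriv α g x| ≤ δ)
    (h2 : ∀ α : Fin K → ℕ, ∑ i, α i = strictFloor s → ∀ x y,
      |multiDeriv α g x - multiDeriv α g y| ≤ δ * ‖x - y‖ ^ (s - strictFloor s)) :
    holderENorm s g ≤ ENNReal.ofReal
      (holderTermCount K s * δ) := by
  rw [ENNReal.ofReal_mul (by positivity), ENNReal.ofReal_natCast, holderTermCount]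
  push_cast
  rw [add_mul, Finset.sum_mul]
  unfold holderENorm
  gcongr with j hj
  · rw [← nsmul_eq_mul]
    refine Finset.sum_le_card_nsmul _ _ _ fun α hα => iSup_le fun x => ?_
    refine ENNReal.ofReal_le_ofReal (h1 α ?_ x)
    rw [Finset.mem_range] at hj
    rw [Finset.mem_piAntidiag] at hα
    exact hα.1.le.trans (by omega)
  · rw [← nsmul_eq_mul]
    refine Finset.sum_le_card_nsmul _ _ _ fun α hα => ?_
    refine iSup_le fun x => iSup_le fun y => iSup_le fun hxy => ?_
    refine ENNReal.ofReal_le_ofReal ?_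
    rw [Finset.mem_piAntidiag] at hα
    have hpos : 0 < ‖x - y‖ := norm_pos_iff.2 (sub_ne_zero.2 hxy)
    rw [div_le_iff₀ (Real.rpow_pos_of_pos hpos _)]
    exact h2 α hα.1 x y

/-- Interpolation: the Lipschitz bound suffices for $t\le1$, where $t\le t^r$, and the supremum
bound for $t\ge1$, where $1\le t^r$. -/
theorem abs_sub_le_rpow_of_bounds {B r a t : ℝ} (hr0 : 0 < r) (hr1 : r ≤ 1)
    (ht : 0 ≤ t) (h1 : a ≤ 2 * B) (h2 : a ≤ B * t) (hB : 0 ≤ B) : a ≤ 2 * B * t ^ r := by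
  rcases le_total t 1 with h | h
  · have h3 : t ≤ t ^ r := Real.self_le_rpow_of_le_one ht h hr1
    nlinarith [mul_le_mul_of_nonneg_left h3 hB, mul_nonneg hB ht]
  · have h3 : 1 ≤ t ^ r := Real.one_le_rpow h hr0.le
    nlinarith

/-- Small multiples of the rescalings `h ^ s * g (· / h)` of functions with a given sequence of
derivative bounds lie in a Hölder ball, uniformly in the scale `h`. -/
theorem exists_scale_mem_holderBall (C : ℕ → ℝ) {s M : ℝ} (hs : 0 < s) (hM : 0 < M) :
    ∃ ε > 0, ∀ g : EuclideanSpace ℝ (Fin K) → ℝ, HasDerivBounds C g → ∀ c : ℝ, |c| ≤ ε →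
      ∀ h : ℝ, 0 < h → h ≤ 1 → (fun y => c * h ^ s * g (h⁻¹ • y)) ∈ holderBall K s M := by
  set N := strictFloor s with hN
  obtain ⟨T, hT⟩ : ∃ T, holderTermCount K s = T := ⟨_, rfl⟩
  -- Order $N+1$ is included because the Hölder seminorm of a derivative of order $N$ is controlled
  -- by its Lipschitz constant.
  obtain ⟨B, hBpos, hCB⟩ : ∃ B : ℝ, 0 < B ∧ ∀ j ≤ N + 1, C j ≤ B := by
    refine ⟨1 + ∑ j ∈ Finset.range (N + 2), |C j|, by positivity, fun j hj => ?_⟩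
    have h1 : |C j| ≤ ∑ j ∈ Finset.range (N + 2), |C j| :=
      Finset.single_le_sum (f := fun j => |C j|) (fun i _ => abs_nonneg _)
        (Finset.mem_range.2 (show j < N + 2 by omega))
    linarith [le_abs_self (C j)]
  refine ⟨M / (2 * B * (T + 1)), by positivity, fun g hg c hc h h0 h1 => ⟨?_, ?_⟩⟩
  · have : ContDiff ℝ ∞ (fun y : EuclideanSpace ℝ (Fin K) => c * h ^ s * g (h⁻¹ • y)) :=
      contDiff_const.mul (hg.contDiff.comp (contDiff_const_smul _))
    exact this.of_le (by exact_mod_cast le_top)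
  · have hr0 : 0 < s - N := sub_pos.2 (strictFloor_lt hs)
    have hr1 : s - N ≤ 1 := by linarith [le_strictFloor_add_one s]
    have hpow : ∀ j : ℕ, h ^ s * (h⁻¹) ^ j = h ^ (s - j) := fun j => by
      rw [Real.rpow_sub h0, Real.rpow_natCast, inv_pow, div_eq_mul_inv]
    refine (holderENorm_le_of_bounds (δ := 2 * B * |c|) ?_ ?_).trans (ENNReal.ofReal_le_ofReal ?_)
    · intro α hα x
      rw [multiDeriv_scale, mul_assoc c, hpow, abs_mul, abs_mul]
      -- The exponent is nonnegative since $|\alpha|\le N<s$, so scales $h\le1$ do no harm.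
      have e1 : |h ^ (s - ((∑ i, α i : ℕ) : ℝ))| ≤ 1 := by
        rw [abs_of_nonneg (by positivity)]
        refine Real.rpow_le_one h0.le h1 ?_
        have : ((∑ i, α i : ℕ) : ℝ) ≤ N := by exact_mod_cast hα
        linarith
      have e2 : |multiDeriv α g (h⁻¹ • x)| ≤ B :=
        ((hg.multiDeriv α).abs_le _).trans (hCB _ (by omega))
      calc _ ≤ |c| * 1 * B := by gcongr
        _ ≤ 2 * B * |c| := by nlinarith [abs_nonneg c]
    · intro α hα x y
      rw [multiDeriv_scale, mul_assoc c, hpow, hα, ← mul_sub, abs_mul, abs_mul,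
        abs_of_nonneg (Real.rpow_nonneg h0.le _)]
      have hb0 : ∀ z, |multiDeriv α g z| ≤ B := fun z =>
        ((hg.multiDeriv α).abs_le _).trans (hCB _ (by omega))
      have e := abs_sub_le_rpow_of_bounds (B := B) hr0 hr1 (norm_nonneg (h⁻¹ • x - h⁻¹ • y))
        (a := |multiDeriv α g (h⁻¹ • x) - multiDeriv α g (h⁻¹ • y)|)
        ((abs_sub _ _).trans (by linarith [hb0 (h⁻¹ • x), hb0 (h⁻¹ • y)]))
        (((hg.multiDeriv α).norm_sub_le _ _).trans (by
          gcongr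
          exact hCB _ (by omega))) hBpos.le
      -- At top order the amplitude cancels the dilation exactly; hence the bound is uniform in $h$.
      have e3 : h ^ (s - N) * ‖h⁻¹ • x - h⁻¹ • y‖ ^ (s - N) = ‖x - y‖ ^ (s - N) := by
        rw [← smul_sub, norm_smul, Real.norm_of_nonneg (by positivity),
          ← Real.mul_rpow h0.le (by positivity), ← mul_assoc, mul_inv_cancel₀ h0.ne', one_mul]
      calc |c| * h ^ (s - N) * |multiDeriv α g (h⁻¹ • x) - multiDeriv α g (h⁻¹ • y)|
          ≤ |c| * h ^ (s - N) * (2 * B * ‖h⁻¹ • x - h⁻¹ • y‖ ^ (s - N)) := by gcongr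
        _ = 2 * B * |c| * (h ^ (s - N) * ‖h⁻¹ • x - h⁻¹ • y‖ ^ (s - N)) := by ring
        _ = _ := by rw [e3]
    · rw [hT]
      calc (T : ℝ) * (2 * B * |c|) ≤ (T + 1) * (2 * B * (M / (2 * B * (T + 1)))) := by
            gcongr
            linarith
        _ = M := by field_simp

theorem exists_const_mul_coord_mem_holderBall {χ : ℝ → ℝ} {C : ℕ → ℝ} (hχ : HasDerivBounds C χ)
    {s M : ℝ} (hs : 0 < s) (hM : 0 < M) (i : Fin K) :
    ∃ ε > 0, ∀ c : ℝ, |c| ≤ ε → (fun y => c * χ (y i)) ∈ holderBall K s M := by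
  obtain ⟨ε, hε, h⟩ := exists_scale_mem_holderBall (K := K) C hs hM
  refine ⟨ε, hε, fun c hc => ?_⟩
  have hL : ‖(EuclideanSpace.proj i : EuclideanSpace ℝ (Fin K) →L[ℝ] ℝ)‖ ≤ 1 :=
    ContinuousLinearMap.opNorm_le_bound _ zero_le_one fun x => by
      simpa using PiLp.norm_apply_le x i
  have := h _ (hχ.comp_clm _ hL) c hc 1 one_pos le_rfl
  simpa using this

theorem exists_const_mem_holderBall (K : ℕ) {s M : ℝ} (hs : 0 < s) (hM : 0 < M) :
    ∃ ε > 0, ∀ c : ℝ, |c| ≤ ε → (fun _ => c) ∈ holderBall K s M := by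
  have h1 : HasDerivBounds (fun _ => 1) (fun _ : EuclideanSpace ℝ (Fin K) => (1 : ℝ)) := by
    refine ⟨contDiff_const, fun n x => ?_⟩
    rcases n with _ | n
    · simp
    · simp [iteratedFDeriv_succ_const]
  obtain ⟨ε, hε, h⟩ := exists_scale_mem_holderBall (K := K) _ hs hM
  exact ⟨ε, hε, fun c hc => by simpa using h _ h1 c hc 1 one_pos le_rfl⟩

/-- The function `y ↦ min(max(y, 0), 1) ^ s`. -/
def clipPow (s y : ℝ) : ℝ := min (max y 0) 1 ^ s

theorem clipPow_of_mem {s y : ℝ} (h0 : 0 ≤ y) (h1 : y ≤ 1) : clipPow s y = y ^ s := by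
  simp [clipPow, h0, h1]

theorem abs_clipPow_le {s : ℝ} (hs : 0 ≤ s) (y : ℝ) : |clipPow s y| ≤ 1 := by
  have h : 0 ≤ min (max y 0) 1 := by positivity
  rw [clipPow, abs_of_nonneg (Real.rpow_nonneg h _)]
  exact Real.rpow_le_one h (min_le_right _ _) hs

/-- Subadditivity of $u\mapsto u^s$ applied to $u=(u-v)+v$. -/
theorem abs_rpow_sub_rpow_le {s u v : ℝ} (hs0 : 0 ≤ s) (hs1 : s ≤ 1) (hu : 0 ≤ u) (hv : 0 ≤ v) :
    |u ^ s - v ^ s| ≤ |u - v| ^ s := by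
  wlog h : v ≤ u generalizing u v
  · rw [abs_sub_comm, abs_sub_comm u]
    exact this hv hu (le_of_not_ge h)
  rw [abs_of_nonneg (sub_nonneg.2 (Real.rpow_le_rpow hv h hs0)), abs_of_nonneg (sub_nonneg.2 h)]
  have := Real.rpow_add_le_add_rpow (sub_nonneg.2 h) hv hs0 hs1
  rw [sub_add_cancel] at this
  linarith

theorem abs_clipPow_sub_le {s : ℝ} (hs0 : 0 ≤ s) (hs1 : s ≤ 1) (x y : ℝ) :
    |clipPow s x - clipPow s y| ≤ |x - y| ^ s := by
  refine (abs_rpow_sub_rpow_le hs0 hs1 (by positivity) (by positivity)).trans ?_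
  refine Real.rpow_le_rpow (abs_nonneg _) ?_ hs0
  refine (abs_min_sub_min_le_max _ _ _ _).trans (max_le ?_ (by simp))
  exact (abs_max_sub_max_le_max _ _ _ _).trans (max_le le_rfl (by simp))

theorem exists_const_mul_clipPow_mem_holderBall {s M : ℝ} (hs : 0 < s) (hs1 : s < 1) (hM : 0 < M)
    (i : Fin K) : ∃ ε > 0, ∀ c : ℝ, |c| ≤ ε → (fun y => c * clipPow s (y i)) ∈ holderBall K s M := by
  have h0 : strictFloor s = 0 := by
    have : ⌈s⌉₊ ≤ 1 := Nat.ceil_le.2 (by simpa using hs1.le)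
    unfold strictFloor; omega
  obtain ⟨T, hT⟩ : ∃ T, holderTermCount K s = T := ⟨_, rfl⟩
  -- For $s<1$ only the zero multi-index enters the norm, so the cusp of the power at $0$ is never
  -- differentiated.
  have hm : ∀ (α : Fin K → ℕ) (g : EuclideanSpace ℝ (Fin K) → ℝ), ∑ i, α i ≤ strictFloor s →
      multiDeriv α g = g := by
    intro α g hα
    have hz : ∀ i, α i = 0 := by
      rw [h0, Nat.le_zero, Finset.sum_eq_zero_iff] at hα
      exact fun i => hα i (Finset.mem_univ _)
    unfold multiDeriv
    induction List.finRange K with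
    | nil => rfl
    | cons i l ih => rw [List.foldr_cons, ih, hz i, Function.iterate_zero, id]
  refine ⟨M / (T + 1), by positivity, fun c hc => ⟨?_, ?_⟩⟩
  · rw [h0]
    have : Continuous (fun y : EuclideanSpace ℝ (Fin K) => c * clipPow s (y i)) := by
      unfold clipPow
      exact continuous_const.mul (Continuous.rpow_const (by fun_prop) fun _ => Or.inr hs.le)
    exact_mod_cast contDiff_zero.2 this
  · refine (holderENorm_le_of_bounds (δ := |c|) ?_ ?_).trans (ENNReal.ofReal_le_ofReal ?_)
    · intro α hα x
      rw [hm _ _ hα, abs_mul]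
      exact mul_le_of_le_one_right (abs_nonneg c) (abs_clipPow_le hs.le _)
    · intro α hα x y
      rw [hm _ _ hα.le, ← mul_sub, abs_mul, h0, Nat.cast_zero, sub_zero]
      gcongr
      refine (abs_clipPow_sub_le hs.le hs1.le _ _).trans ?_
      refine Real.rpow_le_rpow (abs_nonneg _) ?_ hs.le
      simpa using PiLp.norm_apply_le (x - y) i
    · rw [hT]
      calc (T : ℝ) * |c| ≤ (T + 1) * (M / (T + 1)) := by gcongr; linarith
        _ = M := by field_simp

end Holder
end

/-! ### Building elements of the hierarchical class -/

noncomputable section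
open scoped ContDiff

/-- There is a smooth function on the line with bounded derivatives that is the identity on
`[0, 1]`. -/
theorem exists_truncated_identity :
    ∃ (χ : ℝ → ℝ) (C : ℕ → ℝ), HasDerivBounds C χ ∧ ∀ u, 0 ≤ u → u ≤ 1 → χ u = u := by
  let b : ContDiffBump (0 : ℝ) := ⟨1, 2, one_pos, one_lt_two⟩
  have hs : HasCompactSupport fun u => u * b u := b.hasCompactSupport.mul_left
  obtain ⟨C, hC⟩ := exists_hasDerivBounds_of_hasCompactSupport (contDiff_id.mul b.contDiff) hs
  refine ⟨_, C, hC, fun u h0 h1 => ?_⟩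
  have : b u = 1 := b.one_of_mem_closedBall (by
    simpa [abs_of_nonneg h0] using h1)
  simp [this]

namespace SDTree

variable {d : ℕ} {Ω : Set (EuclideanSpace ℝ (Fin d))} {M : ℝ}

/-- A coordinate is passed up through the first child of every node, by outer functions that ignore
their other arguments. The bound $a_0\le1$ keeps the intermediate values in $[0,1]$, where the
truncated identity is the identity. These functions serve below the chosen node and in the branches
that play no role. -/
theorem exists_const_mul_coord_mem (hΩ : ∀ x ∈ Ω, ∀ i, x i ∈ Set.Icc (0 : ℝ) 1) (hM : 0 < M)
    (t : SDTree) (ht : t.Admissible) :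
    ∃ a₀, 0 < a₀ ∧ a₀ ≤ 1 ∧ ∀ a, 0 ≤ a → a ≤ a₀ → ∀ i : Fin d,
      (fun x : Ω => a * x.1 i) ∈ t.hierarchicalClass M Ω := by
  obtain ⟨χ, C, hC, hχ⟩ := exists_truncated_identity
  induction t with
  | leaf s K =>
    obtain ⟨hs, hK⟩ := ht
    obtain ⟨ε, hε, h⟩ := exists_const_mul_coord_mem_holderBall (K := K) hC hs hM ⟨0, hK⟩
    refine ⟨min ε 1, by positivity, min_le_right _ _, fun a ha0 ha i => ?_⟩
    refine ⟨_, h a ?_, fun _ => i, fun x => ?_⟩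
    · rw [abs_of_nonneg ha0]; exact ha.trans (min_le_left _ _)
    · simp [hχ _ (hΩ x.1 x.2 i).1 (hΩ x.1 x.2 i).2]
  | node s K sub ih =>
    obtain ⟨hs, hK, hsub⟩ := ht
    obtain ⟨ε, hε, h⟩ := exists_const_mul_coord_mem_holderBall (K := K) hC hs hM ⟨0, hK⟩
    choose b hb0 hb1 hb using fun k => ih k (hsub k)
    have hp := hb0 ⟨0, hK⟩
    refine ⟨min (ε * b ⟨0, hK⟩) 1, by positivity, min_le_right _ _, fun a ha0 ha i => ?_⟩
    refine ⟨_, h (a / b ⟨0, hK⟩) ?_, fun k x => b k * x.1 i,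
      fun k => hb k _ (hb0 k).le le_rfl i, fun x => ?_⟩
    · rw [abs_of_nonneg (by positivity), div_le_iff₀ hp]
      exact ha.trans (min_le_left _ _)
    · have hx := hΩ x.1 x.2 i
      simp only
      rw [hχ _ (mul_nonneg hp.le hx.1) (mul_le_one₀ (hb1 _) hx.1 hx.2)]
      field_simp

/-- The outer function alone is constant; the subtrees only need some member each, and this is where
$d>0$ enters. -/
theorem exists_const_mem (hΩ : ∀ x ∈ Ω, ∀ i, x i ∈ Set.Icc (0 : ℝ) 1) (hM : 0 < M)
    (hd : 0 < d) (t : SDTree) (ht : t.Admissible) :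
    ∃ ε > 0, ∀ c : ℝ, |c| ≤ ε → (fun _ : Ω => c) ∈ t.hierarchicalClass M Ω := by
  cases t with
  | leaf s K =>
    obtain ⟨ε, hε, h⟩ := exists_const_mem_holderBall K ht.1 hM
    exact ⟨ε, hε, fun c hc => ⟨_, h c hc, fun _ => ⟨0, hd⟩, fun x => rfl⟩⟩
  | node s K sub =>
    obtain ⟨ε, hε, h⟩ := exists_const_mem_holderBall K ht.1 hM
    choose b hb0 hb1 hb using fun k => exists_const_mul_coord_mem hΩ hM (sub k) (ht.2.2 k)
    exact ⟨ε, hε, fun c hc => ⟨_, h c hc, _, fun k => hb k _ (hb0 k).le le_rfl ⟨0, hd⟩,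
      fun x => rfl⟩⟩

theorem Node.pos_of_admissible {t : SDTree} (G : t.Node) (ht : t.Admissible) :
    0 < G.smoothness ∧ 1 ≤ G.dim ∧ 0 < G.ancestorFactor := by
  induction G with
  | root t => cases t with
    | leaf s K => exact ⟨ht.1, ht.2, one_pos⟩
    | node s K sub => exact ⟨ht.1, ht.2.1, one_pos⟩
  | child k G ih =>
    obtain ⟨h1, h2, h3⟩ := ih (ht.2.2 k)
    exact ⟨h1, h2, mul_pos (lt_min one_pos ht.1) h3⟩

/-- A scalar function that acts on `[0, 1]` as a small multiple of `y ↦ y ^ min(1, s)` and lies in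
the Hölder ball of smoothness `s`, as a function of one of the coordinates. -/
theorem exists_power_mem_holderBall {K : ℕ} {s : ℝ} (hs : 0 < s) (hM : 0 < M) (i : Fin K) :
    ∃ (φ : ℝ → ℝ) (c : ℝ), 0 < c ∧ c ≤ 1 ∧ (∀ y, 0 ≤ y → y ≤ 1 → φ y = c * y ^ min 1 s) ∧
      (fun y => φ (y i)) ∈ holderBall K s M := by
  rcases lt_or_ge s 1 with h1 | h1
  · obtain ⟨ε, hε, h⟩ := exists_const_mul_clipPow_mem_holderBall hs h1 hM i
    refine ⟨fun y => min ε 1 * clipPow s y, min ε 1, by positivity, min_le_right _ _,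
      fun y hy0 hy1 => ?_, h _ ?_⟩
    · simp only
      rw [clipPow_of_mem hy0 hy1, min_eq_right (b := s) h1.le]
    · rw [abs_of_pos (by positivity)]
      exact min_le_left _ _
  · obtain ⟨χ, C, hC, hχ⟩ := exists_truncated_identity
    obtain ⟨ε, hε, h⟩ := exists_const_mul_coord_mem_holderBall hC hs hM i
    refine ⟨fun y => min ε 1 * χ y, min ε 1, by positivity, min_le_right _ _,
      fun y hy0 hy1 => ?_, h _ ?_⟩
    · simp only
      rw [hχ y hy0 hy1, min_eq_left h1, Real.rpow_one]
    · rw [abs_of_pos (by positivity)]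
      exact min_le_left _ _

/-- Functions in the Hölder ball of a node can be lifted to the hierarchical class: the functions
at the ancestors compose to a multiple of a power function, and the functions at the descendants
to multiples of coordinates. -/
theorem Node.exists_lift (hΩ : ∀ x ∈ Ω, ∀ i, x i ∈ Set.Icc (0 : ℝ) 1) (hM : 0 < M)
    {t : SDTree} (G : t.Node) (ht : t.Admissible) :
    ∃ (F : ℝ → ℝ) (c : ℝ) (a : Fin G.dim → ℝ), 0 < c ∧ c ≤ 1 ∧
      (∀ y, 0 ≤ y → y ≤ 1 → F y = c * y ^ G.ancestorFactor) ∧ (∀ k, 0 < a k ∧ a k ≤ 1) ∧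
      ∀ g ∈ holderBall G.dim G.smoothness M, ∀ π : Fin G.dim → Fin d,
        (fun x : Ω => F (g (WithLp.toLp 2 fun k => a k * x.1 (π k)))) ∈
          t.hierarchicalClass M Ω := by
  induction G with
  | root t => cases t with
    | leaf s K =>
      refine ⟨id, 1, fun _ => 1, one_pos, le_rfl, fun y _ _ => ?_, fun _ => ⟨one_pos, le_rfl⟩,
        fun g hg π => ⟨g, hg, π, fun x => ?_⟩⟩
      · simp [Node.ancestorFactor]
      · simp only [one_mul, id]
        rfl
    | node s K sub =>
      choose b hb0 hb1 hb using fun k => exists_const_mul_coord_mem hΩ hM (sub k) (ht.2.2 k)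
      refine ⟨id, 1, b, one_pos, le_rfl, fun y _ _ => ?_, fun k => ⟨hb0 k, hb1 k⟩,
        fun g hg π => ⟨g, hg, fun k x => b k * x.1 (π k), fun k => ?_, fun x => rfl⟩⟩
      · simp [Node.ancestorFactor]
      · exact hb k _ (hb0 k).le le_rfl _
  | @child s K sub k G ih =>
    obtain ⟨F, c, a, hc0, hc1, hF, ha, hmem⟩ := ih (ht.2.2 k)
    obtain ⟨φ, e, he0, he1, hφ, hφm⟩ := exists_power_mem_holderBall (K := K) ht.1 hM k
    have hA := (G.pos_of_admissible (ht.2.2 k)).2.2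
    have hs1 : 0 < min 1 s := lt_min one_pos ht.1
    -- $e\,(c\,y^A)^{\min(1,s)}=e\,c^{\min(1,s)}\,y^{A\min(1,s)}$; the requirement $c\le1$ keeps
    -- $F(y)$ in $[0,1]$, where $\varphi$ is a power.
    refine ⟨fun y => φ (F y), e * c ^ min 1 s, a, by positivity, ?_, fun y h0 h1 => ?_, ha,
      fun g hg π => ?_⟩
    · exact mul_le_one₀ he1 (by positivity) (Real.rpow_le_one hc0.le hc1 hs1.le)
    · have hy : y ^ G.ancestorFactor ≤ 1 := Real.rpow_le_one h0 h1 hA.le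
      have hy0 : 0 ≤ y ^ G.ancestorFactor := by positivity
      simp only
      rw [hF y h0 h1, hφ _ (by positivity) (mul_le_one₀ hc1 hy0 hy), Real.mul_rpow hc0.le hy0,
        ← Real.rpow_mul h0, Node.ancestorFactor, mul_comm (min 1 s) G.ancestorFactor, mul_assoc]
    · choose b hb0 hb1 hb using fun j => exists_const_mul_coord_mem hΩ hM (sub j) (ht.2.2 j)
      by_cases hd : Nonempty (Fin d)
      · obtain ⟨i⟩ := hd
        -- The outer function reads only argument $k$; the siblings receive arbitrary members of
        -- their classes.
        refine ⟨_, hφm, Function.update (fun j (x : Ω) => b j * x.1 i) k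
          (fun x : Ω => F (g (WithLp.toLp 2 fun k => a k * x.1 (π k)))), fun j => ?_,
          fun x => ?_⟩
        · by_cases hj : j = k
          · subst hj
            rw [Function.update_self]
            exact hmem g hg π
          · rw [Function.update_of_ne hj]
            exact hb j _ (hb0 j).le le_rfl _
        · simp
      · exact absurd ⟨π ⟨0, (G.pos_of_admissible (ht.2.2 k)).2.1⟩⟩ hd

end SDTree
end

noncomputable section
open ProbabilityTheory
open scoped NNReal

/-! ### Densities and integrals on product spaces -/

section Product

variable {ι : Type*} [Fintype ι] {X : ι → Type*} [∀ i, MeasurableSpace (X i)]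

theorem lintegral_pi_prod {μ : ∀ i, Measure (X i)} [∀ i, IsProbabilityMeasure (μ i)]
    {f : ∀ i, X i → ℝ≥0∞} (hf : ∀ i, Measurable (f i)) :
    ∫⁻ x, ∏ i, f i (x i) ∂Measure.pi μ = ∏ i, ∫⁻ y, f i y ∂μ i := by
  have h := lintegral_prod_eq_prod_lintegral_of_indepFun Finset.univ
    (fun i (x : ∀ i, X i) => f i (x i)) (iIndepFun_pi (μ := μ) fun i => (hf i).aemeasurable)
    fun i => (hf i).comp (measurable_pi_apply i)
  rw [h]
  exact Finset.prod_congr rfl fun i _ => (measurePreserving_eval μ i).lintegral_comp (hf i)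

theorem pi_withDensity {μ : ∀ i, Measure (X i)} [∀ i, IsProbabilityMeasure (μ i)]
    {f : ∀ i, X i → ℝ≥0∞} (hf : ∀ i, Measurable (f i))
    [∀ i, SigmaFinite ((μ i).withDensity (f i))] :
    Measure.pi (fun i => (μ i).withDensity (f i)) =
      (Measure.pi μ).withDensity fun x => ∏ i, f i (x i) := by
  refine Measure.pi_eq fun s hs => ?_
  rw [withDensity_apply _ (MeasurableSet.univ_pi hs),
    ← lintegral_indicator (MeasurableSet.univ_pi hs)]
  have h : ∀ x : ∀ i, X i, (Set.univ.pi s).indicator (fun x => ∏ i, f i (x i)) x =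
      ∏ i, (s i).indicator (f i) (x i) := by
    intro x
    classical
    by_cases hx : x ∈ Set.univ.pi s
    · rw [Set.indicator_of_mem hx]
      exact Finset.prod_congr rfl fun i _ => by rw [Set.indicator_of_mem (hx i trivial)]
    · rw [Set.indicator_of_notMem hx]
      simp only [Set.mem_pi, not_forall] at hx
      obtain ⟨i, _, hi⟩ := hx
      exact (Finset.prod_eq_zero (Finset.mem_univ i) (by rw [Set.indicator_of_notMem hi])).symm
  simp_rw [h]
  rw [lintegral_pi_prod fun i => (hf i).indicator (hs i)]
  exact Finset.prod_congr rfl fun i _ => by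
    rw [lintegral_indicator (hs i), withDensity_apply _ (hs i)]

end Product

/-! ### Gaussian likelihood ratios and moments -/

section Gaussian

/-- The logarithm of the likelihood ratio of `N(a, v)` and `N(0, v)`. -/
def gaussianLLR (v : ℝ≥0) (a y : ℝ) : ℝ := a * y / v - a ^ 2 / (2 * v)

@[fun_prop]
theorem measurable_gaussianLLR {α : Type*} [MeasurableSpace α] {v : ℝ≥0} {f g : α → ℝ}
    (hf : Measurable f) (hg : Measurable g) : Measurable fun x => gaussianLLR v (f x) (g x) := by
  unfold gaussianLLR; fun_prop

theorem gaussianReal_eq_withDensity (a : ℝ) {v : ℝ≥0} (hv : v ≠ 0) :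
    gaussianReal a v =
      (gaussianReal 0 v).withDensity fun y => ENNReal.ofReal (Real.exp (gaussianLLR v a y)) := by
  have hm : Measurable fun y => ENNReal.ofReal (Real.exp (gaussianLLR v a y)) := by
    fun_prop
  rw [gaussianReal_of_var_ne_zero _ hv, gaussianReal_of_var_ne_zero _ hv,
    ← withDensity_mul _ (measurable_gaussianPDF _ _) hm]
  congr 1
  funext y
  have hv' : (v : ℝ) ≠ 0 := by exact_mod_cast hv
  rw [Pi.mul_apply, gaussianPDF, gaussianPDF, ← ENNReal.ofReal_mul (gaussianPDFReal_nonneg _ _ _),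
    gaussianPDFReal, gaussianPDFReal, mul_assoc (√_)⁻¹ (Real.exp _),
    ← Real.exp_add, gaussianLLR]
  congr 3
  field_simp
  ring

theorem lintegral_exp_mul_gaussianReal (t : ℝ) (v : ℝ≥0) :
    ∫⁻ y, ENNReal.ofReal (Real.exp (t * y)) ∂gaussianReal 0 v =
      ENNReal.ofReal (Real.exp (v * t ^ 2 / 2)) := by
  rw [← ofReal_integral_eq_lintegral_ofReal (integrable_exp_mul_gaussianReal t)
    (ae_of_all _ fun _ => (Real.exp_pos _).le)]
  congr 1
  have := congrFun (mgf_id_gaussianReal (μ := 0) (v := v)) t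
  simpa [mgf] using this

theorem lintegral_exp_gaussianLLR (a : ℝ) {v : ℝ≥0} (hv : v ≠ 0) :
    ∫⁻ y, ENNReal.ofReal (Real.exp (gaussianLLR v a y)) ∂gaussianReal 0 v = 1 := by
  have h := measure_univ (μ := gaussianReal a v)
  rwa [gaussianReal_eq_withDensity a hv, withDensity_apply _ MeasurableSet.univ,
    Measure.restrict_univ] at h

/-- With densities $p_a,p_b$ of $N(a,v),N(b,v)$, the left side is $\int p_b^2/p_a$, that is, one
plus the $\chi^2$-divergence. It multiplies over independent observations. -/
theorem lintegral_exp_two_mul_gaussianLLR_sub (a b : ℝ) {v : ℝ≥0} (hv : v ≠ 0) :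
    ∫⁻ y, ENNReal.ofReal (Real.exp (2 * gaussianLLR v b y - gaussianLLR v a y)) ∂gaussianReal 0 v =
      ENNReal.ofReal (Real.exp ((b - a) ^ 2 / v)) := by
  have hv' : (v : ℝ) ≠ 0 := by exact_mod_cast hv
  have h : ∀ y, ENNReal.ofReal (Real.exp (2 * gaussianLLR v b y - gaussianLLR v a y)) =
      ENNReal.ofReal (Real.exp (-(2 * b ^ 2 - a ^ 2) / (2 * v))) *
        ENNReal.ofReal (Real.exp ((2 * b - a) / v * y)) := by
    intro y
    rw [← ENNReal.ofReal_mul (Real.exp_pos _).le, ← Real.exp_add, gaussianLLR, gaussianLLR]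
    congr 2
    ring
  simp_rw [h]
  rw [lintegral_const_mul _ (by fun_prop), lintegral_exp_mul_gaussianReal,
    ← ENNReal.ofReal_mul (Real.exp_pos _).le, ← Real.exp_add]
  congr 2
  field_simp
  ring

/-- From $x\le x^2/3+3/4$ one gets $e^{|t|}\le(e^{2t}+e^{-2t})/3+3/4$. Both exponential moments are
at most $e^{1/4}\le3/2$, so the total is at most $7/4$. -/
theorem lintegral_exp_abs_gaussianReal_le {b : ℝ} {v : ℝ≥0} (hb : 0 < b)
    (hv : (v : ℝ) ≤ b ^ 2 / 8) :
    ∫⁻ y, ENNReal.ofReal (Real.exp |y / b|) ∂gaussianReal 0 v ≤ 2 := by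
  have hpt : ∀ y : ℝ, ENNReal.ofReal (Real.exp |y / b|) ≤
      ENNReal.ofReal (1 / 3) * (ENNReal.ofReal (Real.exp (2 / b * y)) +
        ENNReal.ofReal (Real.exp (-(2 / b) * y))) + ENNReal.ofReal (3 / 4) := by
    intro y
    rw [← ENNReal.ofReal_add (Real.exp_pos _).le (Real.exp_pos _).le,
      ← ENNReal.ofReal_mul (by norm_num), ← ENNReal.ofReal_add (by positivity) (by norm_num)]
    apply ENNReal.ofReal_le_ofReal
    have h1 : Real.exp (2 / b * y) = Real.exp (y / b) ^ 2 := by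
      rw [← Real.exp_nat_mul]; congr 1; push_cast; ring
    have h2 : Real.exp (-(2 / b) * y) = Real.exp (-(y / b)) ^ 2 := by
      rw [← Real.exp_nat_mul]; congr 1; push_cast; ring
    rw [h1, h2]
    rcases abs_cases (y / b) with ⟨h, _⟩ | ⟨h, _⟩ <;> rw [h] <;>
      nlinarith [sq_nonneg (Real.exp (y / b) - 3 / 2), sq_nonneg (Real.exp (-(y / b)) - 3 / 2),
        sq_nonneg (Real.exp (y / b)), sq_nonneg (Real.exp (-(y / b)))]
  refine (lintegral_mono hpt).trans ?_
  rw [lintegral_add_right _ measurable_const, lintegral_const_mul _ (by fun_prop),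
    lintegral_add_left (by fun_prop), lintegral_exp_mul_gaussianReal,
    lintegral_exp_mul_gaussianReal, lintegral_const, measure_univ, mul_one,
    ← ENNReal.ofReal_add (Real.exp_pos _).le (Real.exp_pos _).le,
    ← ENNReal.ofReal_mul (by norm_num), ← ENNReal.ofReal_add (by positivity) (by norm_num)]
  refine ENNReal.ofReal_le_of_le_toReal ?_
  have hx : (v : ℝ) * (2 / b) ^ 2 / 2 ≤ 1 / 4 := by
    rw [div_pow, mul_div_assoc', div_div, div_le_iff₀ (by positivity)]
    nlinarith
  have hx2 : (v : ℝ) * (-(2 / b)) ^ 2 / 2 ≤ 1 / 4 := by rwa [neg_sq]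
  have he : Real.exp (1 / 4) ≤ 3 / 2 := by
    have h4 : Real.exp (1 / 4) ^ 4 ≤ (3 / 2) ^ 4 := by
      rw [← Real.exp_nat_mul]
      have := Real.exp_one_lt_d9
      norm_num
      linarith
    exact le_of_pow_le_pow_left₀ (by norm_num) (by norm_num) h4
  have e1 := Real.exp_le_exp.2 hx
  have e2 := Real.exp_le_exp.2 hx2
  simp only [ENNReal.toReal_ofNat]
  linarith

end Gaussian

/-! ### Overlap of two laws and Assouad's lemma -/

section Assouad

/-- For densities $p_i=e^{u_i}$, AM-GM gives $p_1\le\min(p_0,p_1)+p_1^2/(4p_0)$ pointwise.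
Integrating, the overlap is at least $1-2/4$. -/
theorem one_half_le_lintegral_min {W : Type*} [MeasurableSpace W] {ρ : Measure W} {u₀ u₁ : W → ℝ}
    (h₀ : Measurable u₀) (h₁ : Measurable u₁)
    (hone : ∫⁻ w, ENNReal.ofReal (Real.exp (u₁ w)) ∂ρ = 1)
    (htwo : ∫⁻ w, ENNReal.ofReal (Real.exp (2 * u₁ w - u₀ w)) ∂ρ ≤ 2) :
    1 / 2 ≤ ∫⁻ w, min (ENNReal.ofReal (Real.exp (u₀ w))) (ENNReal.ofReal (Real.exp (u₁ w))) ∂ρ := by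
  have hpt : ∀ w, ENNReal.ofReal (Real.exp (u₁ w)) ≤
      min (ENNReal.ofReal (Real.exp (u₀ w))) (ENNReal.ofReal (Real.exp (u₁ w))) +
        ENNReal.ofReal (1 / 4) * ENNReal.ofReal (Real.exp (2 * u₁ w - u₀ w)) := by
    intro w
    have hmin : min (ENNReal.ofReal (Real.exp (u₀ w))) (ENNReal.ofReal (Real.exp (u₁ w))) =
        ENNReal.ofReal (min (Real.exp (u₀ w)) (Real.exp (u₁ w))) :=
      (Monotone.map_min fun _ _ h => ENNReal.ofReal_le_ofReal h).symm
    rw [hmin, ← ENNReal.ofReal_mul (by norm_num), ← ENNReal.ofReal_add (by positivity)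
      (by positivity)]
    apply ENNReal.ofReal_le_ofReal
    rcases le_total (Real.exp (u₀ w)) (Real.exp (u₁ w)) with h | h
    · rw [min_eq_left h]
      have e : Real.exp (2 * u₁ w - u₀ w) * Real.exp (u₀ w) = Real.exp (u₁ w) ^ 2 := by
        rw [← Real.exp_add, ← Real.exp_nat_mul]; congr 1; push_cast; ring
      have hp := Real.exp_pos (u₀ w)
      refine le_of_mul_le_mul_right ?_ hp
      nlinarith [sq_nonneg (Real.exp (u₀ w) - Real.exp (u₁ w) / 2)]
    · rw [min_eq_right h]
      have := Real.exp_pos (2 * u₁ w - u₀ w)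
      linarith
  have h := lintegral_mono (μ := ρ) hpt
  rw [hone, lintegral_add_left (by fun_prop), lintegral_const_mul _ (by fun_prop)] at h
  have h2 : ENNReal.ofReal (1 / 4) * ∫⁻ w, ENNReal.ofReal (Real.exp (2 * u₁ w - u₀ w)) ∂ρ ≤
      1 / 2 := by
    refine (mul_le_mul_right htwo _).trans (le_of_eq ?_)
    rw [← ENNReal.toReal_eq_toReal_iff' (by finiteness) (by finiteness)]
    rw [ENNReal.toReal_mul, ENNReal.toReal_ofReal (by norm_num)]
    norm_num
  have h3 := h.trans (add_le_add_right h2 _)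
  have h4 : (1 : ℝ≥0∞) = 1 / 2 + 1 / 2 := (ENNReal.add_halves 1).symm
  conv_lhs at h3 => rw [h4]
  exact (ENNReal.add_le_add_iff_right (by finiteness)).1 h3

/-- Assouad's lemma for the squared error of function estimators: if flipping the bit `k` of `ω`
changes `f ω` by at least `Δ` on a set `A k`, and the two corresponding laws, with densities `L`,
overlap by at least one half, then some `f ω` is estimated with error at least
`Δ² / 8 * μ (⋃ k, A k)`. -/
theorem exists_le_squared_error {W X κ : Type*} [MeasurableSpace W] [MeasurableSpace X]
    [Fintype κ] [DecidableEq κ] {ρ : Measure W} {μ : Measure X} [SFinite μ]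
    {L : (κ → Bool) → W → ℝ≥0∞} (hL : ∀ ω, Measurable (L ω))
    {f : (κ → Bool) → X → ℝ} (hf : ∀ ω, Measurable (f ω))
    {A : κ → Set X} (hA : ∀ k, MeasurableSet (A k)) (hdisj : Pairwise (Function.onFun Disjoint A))
    {Δ : ℝ} (hΔ : 0 ≤ Δ)
    (hsep : ∀ ω k, ∀ x ∈ A k, Δ ≤ |f (Function.update ω k !ω k) x - f ω x|)
    (haff : ∀ ω k, 1 / 2 ≤ ∫⁻ w, min (L ω w) (L (Function.update ω k !ω k) w) ∂ρ)
    {T : W → X → ℝ} (hT : Measurable (Function.uncurry T)) :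
    ∃ ω, ENNReal.ofReal (Δ ^ 2 / 8) * μ (⋃ k, A k) ≤
      ∫⁻ w, L ω w * ∫⁻ x, ENNReal.ofReal ((T w x - f ω x) ^ 2) ∂μ ∂ρ := by
  set flip : κ → (κ → Bool) → (κ → Bool) := fun k ω => Function.update ω k !ω k with hflip
  have hinv : ∀ k, Function.Involutive (flip k) := fun k ω => by
    simp [hflip]
  set R : (κ → Bool) → κ → ℝ≥0∞ := fun ω k =>
    ∫⁻ w, L ω w * ∫⁻ x in A k, ENNReal.ofReal ((T w x - f ω x) ^ 2) ∂μ ∂ρ with hR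
  have hmeas : ∀ ω, Measurable fun p : W × X => ENNReal.ofReal ((T p.1 p.2 - f ω p.2) ^ 2) :=
    fun ω => ((hT.sub ((hf ω).comp measurable_snd)).pow_const 2).ennreal_ofReal
  have hmeas' : ∀ ω k, Measurable fun w => ∫⁻ x in A k, ENNReal.ofReal ((T w x - f ω x) ^ 2) ∂μ :=
    fun ω k => (hmeas ω).lintegral_prod_right'
  have hmeasR : ∀ ω k, Measurable fun w =>
      L ω w * ∫⁻ x in A k, ENNReal.ofReal ((T w x - f ω x) ^ 2) ∂μ :=
    fun ω k => (hL ω).mul (hmeas' ω k)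
  have hpair : ∀ ω k, ENNReal.ofReal (Δ ^ 2 / 4) * μ (A k) ≤ R ω k + R (flip k ω) k := by
    intro ω k
    simp only [hR]
    rw [← lintegral_add_left (hmeasR ω k)]
    -- No value of $T$ is close to both functions on $A_k$: $(T-f)^2+(T-f')^2\ge(f-f')^2/2$.
    have hin : ∀ w, ENNReal.ofReal (Δ ^ 2 / 2) * μ (A k) ≤
        (∫⁻ x in A k, ENNReal.ofReal ((T w x - f ω x) ^ 2) ∂μ) +
          ∫⁻ x in A k, ENNReal.ofReal ((T w x - f (flip k ω) x) ^ 2) ∂μ := by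
      intro w
      have hw : Measurable fun x => ENNReal.ofReal ((T w x - f ω x) ^ 2) :=
        (hmeas ω).comp measurable_prodMk_left
      rw [← lintegral_add_left hw, ← setLIntegral_const]
      refine setLIntegral_mono' (hA k) fun x hx => ?_
      rw [← ENNReal.ofReal_add (sq_nonneg _) (sq_nonneg _)]
      apply ENNReal.ofReal_le_ofReal
      have h1 := hsep ω k x hx
      have h2 : Δ ^ 2 ≤ (f (flip k ω) x - f ω x) ^ 2 := by
        rw [← sq_abs (f (flip k ω) x - f ω x)]
        exact pow_le_pow_left₀ hΔ h1 2
      nlinarith [sq_nonneg ((T w x - f ω x) + (T w x - f (flip k ω) x))]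
    calc ENNReal.ofReal (Δ ^ 2 / 4) * μ (A k)
        = 1 / 2 * (ENNReal.ofReal (Δ ^ 2 / 2) * μ (A k)) := by
          rw [← mul_assoc, show Δ ^ 2 / 4 = 1 / 2 * (Δ ^ 2 / 2) by ring,
            ENNReal.ofReal_mul (by norm_num : (0 : ℝ) ≤ 1 / 2)]
          congr 2
          rw [ENNReal.ofReal_div_of_pos two_pos]
          simp
      _ ≤ (∫⁻ w, min (L ω w) (L (flip k ω) w) ∂ρ) * (ENNReal.ofReal (Δ ^ 2 / 2) * μ (A k)) := by
          gcongr
          exact haff ω k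
      _ = ∫⁻ w, min (L ω w) (L (flip k ω) w) * (ENNReal.ofReal (Δ ^ 2 / 2) * μ (A k)) ∂ρ :=
          (lintegral_mul_const _ ((hL ω).min (hL _))).symm
      _ ≤ _ := lintegral_mono fun w => by
          refine (mul_le_mul_right (hin w) _).trans ?_
          rw [mul_add]
          gcongr
          · exact min_le_left _ _
          · exact min_le_right _ _
  -- Flipping bit $k$ permutes the hypercube, so both terms of the pair have the same sum.
  have hsum : ∀ k, ∑ _ω : κ → Bool, ENNReal.ofReal (Δ ^ 2 / 4) * μ (A k) ≤ 2 * ∑ ω, R ω k := by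
    intro k
    refine (Finset.sum_le_sum fun ω _ => hpair ω k).trans (le_of_eq ?_)
    rw [Finset.sum_add_distrib, two_mul]
    congr 1
    exact Equiv.sum_comp (hinv k).toPerm fun ω => R ω k
  have htot : ∀ ω, ∑ k, R ω k ≤
      ∫⁻ w, L ω w * ∫⁻ x, ENNReal.ofReal ((T w x - f ω x) ^ 2) ∂μ ∂ρ := by
    intro ω
    simp only [hR]
    rw [← lintegral_finsetSum _ fun k _ => hmeasR ω k]
    refine lintegral_mono fun w => ?_
    rw [← Finset.mul_sum]
    gcongr
    rw [← tsum_fintype (L := .unconditional _), ← lintegral_iUnion hA hdisj]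
    exact setLIntegral_le_lintegral _ _
  -- The bound holds on average over the hypercube, hence at some vertex.
  by_contra! hcon
  have hlt : ∑ ω : κ → Bool, ∑ k, R ω k <
      ∑ _ω : κ → Bool, ENNReal.ofReal (Δ ^ 2 / 8) * μ (⋃ k, A k) :=
    ENNReal.sum_lt_sum_of_nonempty Finset.univ_nonempty fun ω _ => (htot ω).trans_lt (hcon ω)
  refine absurd hlt (not_lt.2 ?_)
  rw [measure_iUnion hdisj hA, tsum_fintype, Finset.sum_comm]
  simp_rw [Finset.mul_sum]
  rw [Finset.sum_comm]
  refine Finset.sum_le_sum fun k _ => ?_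
  have h2 : (2 : ℝ≥0∞) ≠ 0 := two_ne_zero
  refine (ENNReal.mul_le_mul_iff_right h2 (by finiteness)).1 (le_trans (le_of_eq ?_) (hsum k))
  rw [Finset.mul_sum]
  refine Finset.sum_congr rfl fun ω _ => ?_
  rw [← mul_assoc]
  congr 1
  rw [show (2 : ℝ≥0∞) = ENNReal.ofReal 2 by simp, ← ENNReal.ofReal_mul two_pos.le]
  congr 1
  ring

end Assouad
end

/-! ### Bump functions on a grid and its translates -/

noncomputable section
open scoped ContDiff

/-- At each point at most one summand has a nonzero derivative, because the supports lie in disjoint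
closed sets. The bounds therefore do not grow with the number of summands. -/
theorem hasDerivBounds_sum {E ι : Type*} [NormedAddCommGroup E] [NormedSpace ℝ E] [Fintype ι]
    {C : ℕ → ℝ} (hC : ∀ n, 0 ≤ C n) {g : ι → E → ℝ} (hg : ∀ k, HasDerivBounds C (g k))
    {S : ι → Set E} (hS : ∀ k, IsClosed (S k)) (hdisj : Pairwise (Function.onFun Disjoint S))
    (hsupp : ∀ k, Function.support (g k) ⊆ S k) :
    HasDerivBounds C fun z => ∑ k, g k z := by
  classical
  refine ⟨ContDiff.sum fun k _ => (hg k).contDiff, fun n z => ?_⟩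
  have hn : ∀ k ∈ Finset.univ, ContDiff ℝ n (g k) := fun k _ =>
    (hg k).contDiff.of_le (by exact_mod_cast le_top)
  have h0 : ∀ k, z ∉ S k → iteratedFDeriv ℝ n (g k) z = 0 := fun k hk => by
    by_contra hne
    exact hk (closure_minimal (hsupp k) (hS k) (support_iteratedFDeriv_subset n hne))
  rw [iteratedFDeriv_sum hn, Finset.sum_apply]
  by_cases hz : ∃ k, z ∈ S k
  · obtain ⟨k, hk⟩ := hz
    rw [Finset.sum_eq_single k (fun j _ hj => h0 j fun hzj =>
      Set.disjoint_left.1 (hdisj hj) hzj hk) (by simp)]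
    exact (hg k).bound n z
  · push Not at hz
    rw [Finset.sum_eq_zero fun k _ => h0 k (hz k), norm_zero]
    exact hC n

section Bumps

variable {K N : ℕ}

/-- A smooth function on the line that is `1` on `[1/4, 3/4]` and vanishes outside
`[1/8, 7/8]`. -/
def lineBump : ContDiffBump (1 / 2 : ℝ) := ⟨1 / 4, 3 / 8, by norm_num, by norm_num⟩

theorem lineBump_eq_one {u : ℝ} (h1 : 1 / 4 ≤ u) (h2 : u ≤ 3 / 4) : lineBump u = 1 := by
  refine lineBump.one_of_mem_closedBall ?_
  rw [Real.closedBall_eq_Icc]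
  simp only [lineBump]
  constructor <;> linarith

theorem mem_Icc_of_lineBump_ne_zero {u : ℝ} (h : lineBump u ≠ 0) : u ∈ Set.Icc (1 / 8 : ℝ) (7 / 8) := by
  have h2 : u ∈ Function.support lineBump := h
  rw [lineBump.support_eq, Real.ball_eq_Ioo] at h2
  simp only [lineBump] at h2
  constructor <;> linarith [h2.1, h2.2]

/-- The product of the functions `lineBump` of the coordinates. -/
def cubeBump (z : EuclideanSpace ℝ (Fin K)) : ℝ := ∏ i, lineBump (z i)

theorem cubeBump_mem_Icc (z : EuclideanSpace ℝ (Fin K)) : cubeBump z ∈ Set.Icc (0 : ℝ) 1 :=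
  ⟨Finset.prod_nonneg fun _ _ => lineBump.nonneg,
    Finset.prod_le_one (fun _ _ => lineBump.nonneg) fun _ _ => lineBump.le_one⟩

theorem exists_hasDerivBounds_cubeBump (K : ℕ) :
    ∃ C, HasDerivBounds C (cubeBump : EuclideanSpace ℝ (Fin K) → ℝ) := by
  refine exists_hasDerivBounds_of_hasCompactSupport ?_ ?_
  · exact contDiff_prod fun i _ => lineBump.contDiff.comp
      (EuclideanSpace.proj i : EuclideanSpace ℝ (Fin K) →L[ℝ] ℝ).contDiff
  · have hc : IsCompact (WithLp.toLp 2 '' (Set.univ.pi fun _ : Fin K => Set.Icc (1 / 8 : ℝ) (7 / 8)) :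
        Set (EuclideanSpace ℝ (Fin K))) :=
      (isCompact_univ_pi fun _ => isCompact_Icc).image (PiLp.continuous_toLp 2 _)
    refine HasCompactSupport.of_support_subset_isCompact hc fun z hz => ⟨z.ofLp, fun i _ => ?_, rfl⟩
    exact mem_Icc_of_lineBump_ne_zero (Finset.prod_ne_zero_iff.1 hz i (Finset.mem_univ i))

/-- The sub-cube of the points `z` of the grid cell `k`, for the grid shifted by `-t`, at distance
at least `r` from the boundary of the cell. -/
def innerCell (r : ℝ) (t : Fin K → ℝ) (k : Fin K → Fin N) : Set (EuclideanSpace ℝ (Fin K)) :=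
  {z | ∀ i, z i + (t i - k i) ∈ Set.Icc r (1 - r)}

theorem isClosed_innerCell (r : ℝ) (t : Fin K → ℝ) (k : Fin K → Fin N) :
    IsClosed (innerCell r t k) := by
  have : innerCell r t k = ⋂ i, {z | z i + (t i - k i) ∈ Set.Icc r (1 - r)} := by
    ext z; simp [innerCell]
  rw [this]
  exact isClosed_iInter fun i => isClosed_Icc.preimage (by fun_prop)

theorem innerCell_subset {r r' : ℝ} (h : r ≤ r') (t : Fin K → ℝ) (k : Fin K → Fin N) :
    innerCell r' t k ⊆ innerCell r t k := fun _ hz i =>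
  ⟨h.trans (hz i).1, (hz i).2.trans (by linarith)⟩

theorem pairwise_disjoint_innerCell {r : ℝ} (hr : 0 < r) (t : Fin K → ℝ) :
    Pairwise (Function.onFun Disjoint (innerCell r t : (Fin K → Fin N) → _)) := by
  intro k l hkl
  refine Set.disjoint_left.2 fun z hk hl => hkl (funext fun i => ?_)
  have h1 := hk i
  have h2 := hl i
  have h3 : ((k i : ℕ) : ℝ) < (l i : ℕ) + 1 := by linarith [h1.1, h2.2]
  have h4 : ((l i : ℕ) : ℝ) < (k i : ℕ) + 1 := by linarith [h2.1, h1.2]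
  have h5 : (k i : ℕ) < l i + 1 := by exact_mod_cast h3
  have h6 : (l i : ℕ) < k i + 1 := by exact_mod_cast h4
  exact Fin.ext (by omega)

/-- The term of `bumpField` in the cell `k`. -/
def shiftedBump (t : Fin K → ℝ) (k : Fin K → Fin N) (z : EuclideanSpace ℝ (Fin K)) : ℝ :=
  cubeBump (z + WithLp.toLp 2 fun i => t i - k i)

/-- The sum of the bumps in those cells of the grid, shifted by `-t`, that `θ` selects. -/
def bumpField (t : Fin K → ℝ) (θ : (Fin K → Fin N) → Bool) (z : EuclideanSpace ℝ (Fin K)) : ℝ :=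
  ∑ k, if θ k then shiftedBump t k z else 0

variable (t : Fin K → ℝ) (θ : (Fin K → Fin N) → Bool)

theorem shiftedBump_mem_Icc (k : Fin K → Fin N) (z : EuclideanSpace ℝ (Fin K)) :
    shiftedBump t k z ∈ Set.Icc (0 : ℝ) 1 := cubeBump_mem_Icc _

theorem shiftedBump_eq_zero {k : Fin K → Fin N} {z : EuclideanSpace ℝ (Fin K)}
    (hz : z ∉ innerCell (1 / 8) t k) : shiftedBump t k z = 0 := by
  by_contra h
  rw [shiftedBump, cubeBump] at h
  refine hz fun i => ?_
  have := mem_Icc_of_lineBump_ne_zero (Finset.prod_ne_zero_iff.1 h i (Finset.mem_univ i))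
  rw [show (1 - 1 / 8 : ℝ) = 7 / 8 by norm_num]
  exact this

theorem shiftedBump_eq_one {k : Fin K → Fin N} {z : EuclideanSpace ℝ (Fin K)}
    (hz : z ∈ innerCell (1 / 4) t k) : shiftedBump t k z = 1 := by
  rw [shiftedBump, cubeBump]
  refine Finset.prod_eq_one fun i _ => lineBump_eq_one (hz i).1 ((hz i).2.trans ?_)
  norm_num

theorem bumpField_eq_of_mem {k : Fin K → Fin N} {z : EuclideanSpace ℝ (Fin K)}
    (hz : z ∈ innerCell (1 / 8) t k) :
    bumpField t θ z = if θ k then shiftedBump t k z else 0 := by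
  refine Finset.sum_eq_single k (fun j _ hj => ?_) (by simp)
  rw [shiftedBump_eq_zero t fun hzj => Set.disjoint_left.1
    (pairwise_disjoint_innerCell (by norm_num) t hj) hzj hz, ite_self]

theorem bumpField_mem_Icc (z : EuclideanSpace ℝ (Fin K)) :
    bumpField t θ z ∈ Set.Icc (0 : ℝ) 1 := by
  by_cases h : ∃ k : Fin K → Fin N, z ∈ innerCell (1 / 8) t k
  · obtain ⟨k, hk⟩ := h
    rw [bumpField_eq_of_mem t θ hk]
    split
    · exact shiftedBump_mem_Icc t k z
    · simp
  · push Not at h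
    have : bumpField t θ z = 0 := Finset.sum_eq_zero fun k _ => by
      rw [shiftedBump_eq_zero t (h k), ite_self]
    simp [this]

theorem bumpField_update_of_notMem {k : Fin K → Fin N} {z : EuclideanSpace ℝ (Fin K)} (b : Bool)
    (hz : z ∉ innerCell (1 / 8) t k) :
    bumpField t (Function.update θ k b) z = bumpField t θ z := by
  refine Finset.sum_congr rfl fun j _ => ?_
  by_cases hj : j = k
  · subst hj
    rw [shiftedBump_eq_zero t hz, ite_self, ite_self]
  · rw [Function.update_of_ne hj]

theorem bumpField_eq_of_mem_quarter {k : Fin K → Fin N} {z : EuclideanSpace ℝ (Fin K)}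
    (hz : z ∈ innerCell (1 / 4) t k) : bumpField t θ z = if θ k then 1 else 0 := by
  rw [bumpField_eq_of_mem t θ (innerCell_subset (by norm_num) t k hz), shiftedBump_eq_one t hz]

/-- All summands are translates of one bump, with disjoint supports. It is essential that $C$ does
not depend on $N$, which grows as $h\to0$. -/
theorem exists_hasDerivBounds_bumpField (K : ℕ) :
    ∃ C, ∀ (N : ℕ) (t : Fin K → ℝ) (θ : (Fin K → Fin N) → Bool),
      HasDerivBounds C (bumpField t θ) := by
  obtain ⟨C, hC⟩ := exists_hasDerivBounds_cubeBump K
  refine ⟨C, fun N t θ => ?_⟩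
  refine hasDerivBounds_sum hC.nonneg (fun k => ?_) (S := innerCell (1 / 8) t)
    (fun k => isClosed_innerCell _ t k) (pairwise_disjoint_innerCell (by norm_num) t) fun k z hz => ?_
  · by_cases h : θ k
    · simp only [h, if_true]
      refine ⟨hC.contDiff.comp (contDiff_id.add contDiff_const), fun n x => ?_⟩
      unfold shiftedBump
      rw [iteratedFDeriv_comp_add_right]
      exact hC.bound n _
    · simp only [h]
      refine ⟨contDiff_const, fun n x => ?_⟩
      simpa using hC.nonneg n
  · by_contra h
    exact hz (by simp [shiftedBump_eq_zero t h])

/-- Every point of the region covered by the grid is well inside of a cell, either of the grid or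
of one of its translates by half a cell in some of the directions. -/
theorem exists_mem_innerCell {z : EuclideanSpace ℝ (Fin K)} (h0 : ∀ i, 0 ≤ z i)
    (hN : ∀ i, z i + 1 / 2 < N) :
    ∃ (b : Fin K → Bool) (k : Fin K → Fin N),
      z ∈ innerCell (1 / 4) (fun i => if b i then 1 / 2 else 0) k := by
  have key : ∀ i, ∃ (b : Bool) (k : Fin N),
      z i + ((if b then 1 / 2 else 0) - k) ∈ Set.Icc (1 / 4 : ℝ) (1 - 1 / 4) := by
    intro i
    have hlt : ∀ s : ℝ, 0 ≤ s → s ≤ 1 / 2 → ⌊z i + s⌋₊ < N := fun s hs0 hs =>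
      (Nat.floor_lt (by linarith [h0 i])).2 (by linarith [hN i])
    have f1 := Nat.floor_le (h0 i)
    have f2 := Nat.lt_floor_add_one (z i)
    have g1 := Nat.floor_le (show 0 ≤ z i + 1 / 2 by linarith [h0 i])
    have g2 := Nat.lt_floor_add_one (z i + 1 / 2)
    -- A fractional part outside $[1/4,3/4]$ enters this interval after adding $1/2$; the integer
    -- part grows by one exactly if the fractional part exceeded $3/4$.
    by_cases hz : z i - ⌊z i⌋₊ ∈ Set.Icc (1 / 4 : ℝ) (1 - 1 / 4)
    · refine ⟨false, ⟨⌊z i⌋₊, by simpa using hlt 0 le_rfl (by norm_num)⟩, ?_⟩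
      simpa [sub_eq_add_neg] using hz
    · refine ⟨true, ⟨⌊z i + 1 / 2⌋₊, hlt _ (by norm_num) le_rfl⟩, ?_⟩
      rw [Set.mem_Icc, not_and_or, not_le, not_le] at hz
      simp only [if_true]
      rcases hz with hz | hz
      · have : ⌊z i + 1 / 2⌋₊ = ⌊z i⌋₊ := by
          rw [Nat.floor_eq_iff (by linarith [h0 i])]
          constructor <;> linarith
        rw [this]
        constructor <;> linarith
      · have : ⌊z i + 1 / 2⌋₊ = ⌊z i⌋₊ + 1 := by
          rw [Nat.floor_eq_iff (by linarith [h0 i])]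
          push_cast
          constructor <;> linarith
        rw [this]
        push_cast
        constructor <;> linarith
  choose b k hk using key
  exact ⟨b, k, hk⟩

end Bumps

/-! ### The uniform law on a subset of the cube -/

section UniformLaw

variable {d : ℕ} {Ω : Set (EuclideanSpace ℝ (Fin d))}

/-- The remaining coordinates range over $[0,1]$ and contribute a factor at most one. Injectivity of
$\pi$ makes the $K$ constraints bear on different coordinates, so that their lengths multiply. -/
theorem volume_box_le {K : ℕ} (hΩ : ∀ x ∈ Ω, ∀ i, x i ∈ Set.Icc (0 : ℝ) 1) {π : Fin K → Fin d}
    (hπ : Function.Injective π) (l u : Fin K → ℝ) :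
    volume {x ∈ Ω | ∀ i, x (π i) ∈ Set.Icc (l i) (u i)} ≤ ∏ i, ENNReal.ofReal (u i - l i) := by
  classical
  let B : Fin d → Set ℝ := fun j => Set.Icc 0 1 ∩ ⋂ (i) (_ : π i = j), Set.Icc (l i) (u i)
  have hB : ∀ j, MeasurableSet (B j) := fun j =>
    measurableSet_Icc.inter (.iInter fun i => .iInter fun _ => measurableSet_Icc)
  have hsub : {x ∈ Ω | ∀ i, x (π i) ∈ Set.Icc (l i) (u i)} ⊆ WithLp.ofLp ⁻¹' Set.univ.pi B := by
    rintro x ⟨hx, hbox⟩ j -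
    refine ⟨hΩ x hx j, Set.mem_iInter₂.2 fun i hi => ?_⟩
    rw [← hi]
    exact hbox i
  refine (measure_mono hsub).trans ?_
  rw [(PiLp.volume_preserving_ofLp (Fin d)).measure_preimage
    (MeasurableSet.univ_pi hB).nullMeasurableSet, volume_pi_pi]
  have h1 : ∀ j, volume (B j) ≤ 1 := fun j =>
    (measure_mono Set.inter_subset_left).trans (by simp)
  calc ∏ j, volume (B j) ≤ ∏ j ∈ Finset.univ.image π, volume (B j) :=
        Finset.prod_le_prod_of_subset_of_le_one' (Finset.subset_univ _) fun j _ _ => h1 j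
    _ = ∏ i, volume (B (π i)) := Finset.prod_image fun i _ j _ h => hπ h
    _ ≤ ∏ i, ENNReal.ofReal (u i - l i) := by
        refine Finset.prod_le_prod' fun i _ => ?_
        rw [← Real.volume_Icc]
        exact measure_mono fun y hy => Set.mem_iInter₂.1 hy.2 i rfl

theorem volume_lt_top_of_subset_cube (hΩ : ∀ x ∈ Ω, ∀ i, x i ∈ Set.Icc (0 : ℝ) 1) :
    volume Ω < ⊤ := by
  have h := volume_box_le hΩ (π := id) Function.injective_id 0 1
  have h2 : {x ∈ Ω | ∀ i, x (id i) ∈ Set.Icc ((0 : Fin d → ℝ) i) ((1 : Fin d → ℝ) i)} = Ω :=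
    Set.sep_eq_self_iff_mem_true.2 fun x hx i => hΩ x hx i
  rw [h2] at h
  exact h.trans_lt (by simp)

theorem uniformLaw_apply (hΩm : MeasurableSet Ω) (A : Set (EuclideanSpace ℝ (Fin d))) :
    uniformLaw Ω (Subtype.val ⁻¹' A) = (volume Ω)⁻¹ * volume (Ω ∩ A) := by
  rw [uniformLaw, (MeasurableEmbedding.subtype_coe hΩm).comap_apply,
    Subtype.image_preimage_coe, ProbabilityTheory.cond_apply hΩm, ← Set.inter_assoc, Set.inter_self]

theorem isProbabilityMeasure_uniformLaw (hΩ : ∀ x ∈ Ω, ∀ i, x i ∈ Set.Icc (0 : ℝ) 1)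
    (hΩm : MeasurableSet Ω) (hpos : volume Ω ≠ 0) : IsProbabilityMeasure (uniformLaw Ω) := by
  refine ⟨?_⟩
  have h := uniformLaw_apply hΩm Set.univ
  rw [Set.preimage_univ, Set.inter_univ] at h
  rw [h, ENNReal.inv_mul_cancel hpos (volume_lt_top_of_subset_cube hΩ).ne]

end UniformLaw
end

noncomputable section
open ProbabilityTheory
open scoped NNReal

namespace RandomFunctionModel

variable {d : ℕ} {Ω : Set (EuclideanSpace ℝ (Fin d))} {n m : ℕ}

/-! ### Random constants: the lower bound from the number of subjects -/

section ConstantModel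

/-- The model without noise in which `Z` is a random constant with law `N(a, v)`. -/
def gaussianConstant (Ω : Set (EuclideanSpace ℝ (Fin d))) (v : ℝ≥0) (a : ℝ) :
    RandomFunctionModel Ω where
  S := ℝ
  P := gaussianReal a v
  Z := fun s _ => s
  measurable_Z := fun _ => measurable_id
  integrable_Z := fun _ => memLp_one_iff_integrable.1 (memLp_id_gaussianReal 1)
  noise := Measure.dirac 0
  integrable_noise := integrable_dirac (by simp)
  noise_mean := by simp

theorem gaussianConstant_mean (v : ℝ≥0) (a : ℝ) (x : Ω) : (gaussianConstant Ω v a).mean x = a :=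
  integral_id_gaussianReal

theorem gaussianConstant_subExponential {μX : Measure Ω} [IsProbabilityMeasure μX] {b₂ b₃ : ℝ}
    {v : ℝ≥0} (hb₂ : 0 < b₂) (hv : (v : ℝ) ≤ b₂ ^ 2 / 8) (a : ℝ) :
    (gaussianConstant Ω v a).SubExponential μX b₂ b₃ := by
  have hU : (gaussianConstant Ω v a).U = fun (s : ℝ) _ => s - a := by
    funext s x
    rw [U, gaussianConstant_mean]
    rfl
  refine ⟨fun s => ?_, ?_, ?_⟩
  · rw [hU]
    exact continuous_const
  · rw [hU]
    change ∫⁻ p : ℝ × Ω, ENNReal.ofReal (Real.exp |(p.1 - a) / b₂|) ∂((gaussianReal a v).prod μX) ≤ 2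
    have hm : Measurable fun y : ℝ => ENNReal.ofReal (Real.exp |y / b₂|) := by fun_prop
    rw [lintegral_prod _ (by fun_prop)]
    simp only [lintegral_const, measure_univ, mul_one]
    have hmap : (gaussianReal a v).map (fun s => s - a) = gaussianReal 0 v := by
      rw [gaussianReal_map_sub_const, sub_self]
    have := lintegral_exp_abs_gaussianReal_le hb₂ hv
    rwa [← hmap, lintegral_map hm (by fun_prop)] at this
  · change ∫⁻ e, ENNReal.ofReal (Real.exp |e / b₃|) ∂(Measure.dirac 0) ≤ 2
    rw [lintegral_dirac]
    simp

theorem pi_gaussianReal_eq_withDensity {v : ℝ≥0} (hv : v ≠ 0) (a : ℝ) :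
    Measure.pi (fun _ : Fin n => gaussianReal a v) =
      (Measure.pi fun _ : Fin n => gaussianReal 0 v).withDensity
        fun s => ENNReal.ofReal (Real.exp (∑ i, gaussianLLR v a (s i))) := by
  have : SigmaFinite ((gaussianReal 0 v).withDensity
      fun y => ENNReal.ofReal (Real.exp (gaussianLLR v a y))) := by
    rw [← gaussianReal_eq_withDensity a hv]; infer_instance
  simp_rw [gaussianReal_eq_withDensity a hv]
  rw [pi_withDensity fun _ => by fun_prop]
  congr 1
  funext s
  rw [Real.exp_sum, ENNReal.ofReal_prod_of_nonneg fun _ _ => (Real.exp_pos _).le]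

/-- Rewriting the error under the law with mean zero puts all the models on one space with
densities, as Assouad's lemma requires. -/
theorem gaussianConstant_predictionError (μX : Measure Ω) [IsProbabilityMeasure μX] {v : ℝ≥0}
    (hv : v ≠ 0) (a : ℝ) {T : (Fin n → Fin m → Ω × ℝ) → Ω → ℝ}
    (hT : Measurable (Function.uncurry T)) :
    (gaussianConstant Ω v a).predictionError μX n m T =
      ∫⁻ w : (Fin n → ℝ) × (Fin n → Fin m → Ω) × (Fin n → Fin m → ℝ),
        ENNReal.ofReal (Real.exp (∑ i, gaussianLLR v a (w.1 i))) *
          ∫⁻ x, ENNReal.ofReal ((T (fun i j => (w.2.1 i j, w.1 i + w.2.2 i j)) x - a) ^ 2) ∂μX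
        ∂((Measure.pi fun _ : Fin n => gaussianReal 0 v).prod
          ((Measure.pi fun _ : Fin n => Measure.pi fun _ : Fin m => μX).prod
            (Measure.pi fun _ : Fin n => Measure.pi fun _ : Fin m => Measure.dirac 0))) := by
  have hR : Measurable fun w : (Fin n → ℝ) × (Fin n → Fin m → Ω) × (Fin n → Fin m → ℝ) =>
      ∫⁻ x, ENNReal.ofReal ((T (fun i j => (w.2.1 i j, w.1 i + w.2.2 i j)) x - a) ^ 2) ∂μX := by
    have h1 : Measurable
        fun p : ((Fin n → ℝ) × (Fin n → Fin m → Ω) × (Fin n → Fin m → ℝ)) × Ω =>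
          ((fun i j => (p.1.2.1 i j, p.1.1 i + p.1.2.2 i j) : Fin n → Fin m → Ω × ℝ), p.2) := by
      fun_prop
    have h2 : Measurable
        fun p : ((Fin n → ℝ) × (Fin n → Fin m → Ω) × (Fin n → Fin m → ℝ)) × Ω => ENNReal.ofReal
          ((T (fun i j => (p.1.2.1 i j, p.1.1 i + p.1.2.2 i j)) p.2 - a) ^ 2) :=
      (((hT.comp h1).sub_const _).pow_const 2).ennreal_ofReal
    exact h2.lintegral_prod_right'
  rw [predictionError]
  simp_rw [gaussianConstant_mean]
  change ∫⁻ w : (Fin n → ℝ) × (Fin n → Fin m → Ω) × (Fin n → Fin m → ℝ),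
    ∫⁻ x, ENNReal.ofReal ((T (fun i j => (w.2.1 i j, w.1 i + w.2.2 i j)) x - a) ^ 2) ∂μX
      ∂((Measure.pi fun _ : Fin n => gaussianReal a v).prod
          ((Measure.pi fun _ : Fin n => Measure.pi fun _ : Fin m => μX).prod
            (Measure.pi fun _ : Fin n => Measure.pi fun _ : Fin m => Measure.dirac 0))) = _
  rw [pi_gaussianReal_eq_withDensity hv, prod_withDensity_left (by fun_prop)]
  exact lintegral_withDensity_eq_lintegral_mul _ (by fun_prop) hR

theorem exp_one_half_le_two : Real.exp (1 / 2) ≤ 2 := by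
  have h4 : Real.exp (1 / 2) ^ 2 ≤ 2 ^ 2 := by
    rw [← Real.exp_nat_mul]
    have := Real.exp_one_lt_d9
    norm_num
    linarith
  exact le_of_pow_le_pow_left₀ two_ne_zero two_pos.le h4

/-- Two Gaussian random constants whose means differ by `a` with `n a² ≤ v / 2` cannot be
distinguished from `n` observations, so that one of the means is estimated with a squared error of
at least `a² / 8`. -/
theorem exists_le_predictionError_gaussianConstant {μX : Measure Ω} [IsProbabilityMeasure μX]
    {v : ℝ≥0} (hv : v ≠ 0) {a : ℝ} (ha : 0 ≤ a) (hna : n * a ^ 2 ≤ v / 2)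
    {T : (Fin n → Fin m → Ω × ℝ) → Ω → ℝ} (hT : Measurable (Function.uncurry T)) :
    ∃ b : ℝ, |b| ≤ a ∧ ENNReal.ofReal (a ^ 2 / 8) ≤
      (gaussianConstant Ω v b).predictionError μX n m T := by
  have hv' : (0 : ℝ) < v := by exact_mod_cast pos_iff_ne_zero.2 hv
  -- A two-point comparison is Assouad's lemma with one bit and with separation on all of $\Omega$.
  let mu : (Unit → Bool) → ℝ := fun θ => if θ () then a else 0
  set ρ := (Measure.pi fun _ : Fin n => gaussianReal 0 v).prod
    ((Measure.pi fun _ : Fin n => Measure.pi fun _ : Fin m => μX).prod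
      (Measure.pi fun _ : Fin n => Measure.pi fun _ : Fin m => Measure.dirac (0 : ℝ)))
  have hum : ∀ c : ℝ, Measurable fun w : (Fin n → ℝ) × (Fin n → Fin m → Ω) × (Fin n → Fin m → ℝ) =>
      ∑ i, gaussianLLR v c (w.1 i) := by
    fun_prop
  have hint : ∀ q : ℝ → ℝ, Measurable q →
      ∫⁻ w, ENNReal.ofReal (Real.exp (∑ i, q (w.1 i))) ∂ρ =
        (∫⁻ y, ENNReal.ofReal (Real.exp (q y)) ∂gaussianReal 0 v) ^ n := by
    intro q hq
    have h1 : Measurable fun s : Fin n → ℝ => ENNReal.ofReal (Real.exp (∑ i, q (s i))) := by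
      fun_prop
    rw [measurePreserving_fst.lintegral_comp h1]
    simp_rw [Real.exp_sum, ENNReal.ofReal_prod_of_nonneg fun _ _ => (Real.exp_pos _).le]
    rw [lintegral_pi_prod (f := fun _ y => ENNReal.ofReal (Real.exp (q y))) fun _ => by fun_prop]
    simp
  have hdata : Measurable fun p : ((Fin n → ℝ) × (Fin n → Fin m → Ω) × (Fin n → Fin m → ℝ)) × Ω =>
      ((fun i j => (p.1.2.1 i j, p.1.1 i + p.1.2.2 i j) : Fin n → Fin m → Ω × ℝ), p.2) := by
    fun_prop
  obtain ⟨θ, hθ⟩ := exists_le_squared_error (κ := Unit) (ρ := ρ) (μ := μX)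
    (L := fun θ w => ENNReal.ofReal (Real.exp (∑ i, gaussianLLR v (mu θ) (w.1 i))))
    (fun θ => (hum _).exp.ennreal_ofReal) (f := fun θ _ => mu θ) (fun θ => measurable_const)
    (A := fun _ => Set.univ) (fun _ => MeasurableSet.univ)
    (fun i j hij => absurd (Subsingleton.elim i j) hij) ha
    (fun θ k x _ => by
      cases hθ : θ () <;> simp [mu, hθ, abs_of_nonneg ha])
    (fun θ k => by
      refine one_half_le_lintegral_min (hum _) (hum _) ?_ ?_
      · rw [hint (gaussianLLR v _) (by fun_prop),
          lintegral_exp_gaussianLLR _ hv, one_pow]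
      · simp_rw [Finset.mul_sum, ← Finset.sum_sub_distrib]
        rw [hint (fun y => 2 * gaussianLLR v _ y - gaussianLLR v _ y)
          (by fun_prop), lintegral_exp_two_mul_gaussianLLR_sub _ _ hv,
          ← ENNReal.ofReal_pow (Real.exp_pos _).le, ← Real.exp_nat_mul]
        refine ENNReal.ofReal_le_of_le_toReal ?_
        have hsq : (mu (Function.update θ k !θ k) - mu θ) ^ 2 = a ^ 2 := by
          cases hθ : θ () <;> simp [mu, hθ]
        rw [hsq]
        have h1 : (n : ℝ) * (a ^ 2 / v) ≤ 1 / 2 := by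
          rw [mul_div_assoc', div_le_iff₀ hv']
          linarith
        exact (Real.exp_le_exp.2 h1).trans (by simpa using exp_one_half_le_two))
    (T := fun w => T fun i j => (w.2.1 i j, w.1 i + w.2.2 i j)) (hT.comp hdata)
  refine ⟨mu θ, ?_, ?_⟩
  · cases h : θ () <;> simp [mu, h, ha, abs_of_nonneg ha]
  · rw [Set.iUnion_const, measure_univ, mul_one] at hθ
    exact hθ.trans (gaussianConstant_predictionError μX hv _ hT).ge

end ConstantModel

/-! ### Gaussian regression with $nm$ observations -/

section RegressionModel

/-- The nonparametric regression model: `Z` is the deterministic function `f`, and the noise has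
the law `N(0, v)`. -/
def gaussianRegression (v : ℝ≥0) (f : Ω → ℝ) : RandomFunctionModel Ω where
  S := Unit
  P := Measure.dirac ()
  Z := fun _ x => f x
  measurable_Z := fun _ => measurable_const
  integrable_Z := fun _ => integrable_const _
  noise := gaussianReal 0 v
  integrable_noise := memLp_one_iff_integrable.1 (memLp_id_gaussianReal 1)
  noise_mean := integral_id_gaussianReal

theorem gaussianRegression_mean (v : ℝ≥0) (f : Ω → ℝ) : (gaussianRegression v f).mean = f := by
  funext x
  change ∫ _, f x ∂(Measure.dirac ()) = f x
  simp

theorem gaussianRegression_subExponential {μX : Measure Ω} [IsProbabilityMeasure μX] {b₂ b₃ : ℝ}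
    {v : ℝ≥0} (hb₃ : 0 < b₃) (hv : (v : ℝ) ≤ b₃ ^ 2 / 8) (f : Ω → ℝ) :
    (gaussianRegression v f).SubExponential μX b₂ b₃ := by
  have hU : ∀ s x, (gaussianRegression v f).U s x = 0 := fun s x => by
    rw [U, gaussianRegression_mean]
    exact sub_self _
  refine ⟨fun s => ?_, ?_, lintegral_exp_abs_gaussianReal_le hb₃ hv⟩
  · rw [show (gaussianRegression v f).U s = fun _ => 0 from funext (hU s)]
    exact continuous_const
  · simp [hU]

theorem lintegral_pi_pi_exp_sum {X : Type*} [MeasurableSpace X] (ν : Measure X)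
    [IsProbabilityMeasure ν] {q : Fin n → Fin m → X → ℝ} (hq : ∀ i j, Measurable (q i j)) :
    ∫⁻ y : Fin n → Fin m → X, ENNReal.ofReal (Real.exp (∑ i, ∑ j, q i j (y i j)))
        ∂Measure.pi (fun _ => Measure.pi fun _ => ν) =
      ∏ i, ∏ j, ∫⁻ x, ENNReal.ofReal (Real.exp (q i j x)) ∂ν := by
  simp_rw [Real.exp_sum, ENNReal.ofReal_prod_of_nonneg fun _ _ =>
    Finset.prod_nonneg fun _ _ => (Real.exp_pos _).le, ENNReal.ofReal_prod_of_nonneg fun _ _ => (Real.exp_pos _).le]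
  rw [lintegral_pi_prod (X := fun _ : Fin n => Fin m → X)
    (f := fun i y => ∏ j, ENNReal.ofReal (Real.exp (q i j (y j)))) fun i => by fun_prop]
  refine Finset.prod_congr rfl fun i _ => ?_
  exact lintegral_pi_prod (f := fun j y => ENNReal.ofReal (Real.exp (q i j y))) fun j => by fun_prop

/-- Given the design, the responses are independent $N(a_{ij},v)$; this trades the shifted noise for
a density relative to pure noise, so that the law of the data no longer depends on $f$ except
through that density. -/
theorem lintegral_shift_gaussian {v : ℝ≥0} (hv : v ≠ 0) (a : Fin n → Fin m → ℝ)
    {G : (Fin n → Fin m → ℝ) → ℝ≥0∞} (hG : Measurable G) :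
    ∫⁻ e, G (fun i j => a i j + e i j)
        ∂Measure.pi (fun _ : Fin n => Measure.pi fun _ : Fin m => gaussianReal 0 v) =
      ∫⁻ y, ENNReal.ofReal (Real.exp (∑ i, ∑ j, gaussianLLR v (a i j) (y i j))) * G y
        ∂Measure.pi (fun _ : Fin n => Measure.pi fun _ : Fin m => gaussianReal 0 v) := by
  have hm : ∀ i j, Measurable fun y => ENNReal.ofReal (Real.exp (gaussianLLR v (a i j) y)) := by
    fun_prop
  have hsf : ∀ i j, SigmaFinite ((gaussianReal 0 v).withDensity
      fun y => ENNReal.ofReal (Real.exp (gaussianLLR v (a i j) y))) := fun i j => by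
    rw [← gaussianReal_eq_withDensity _ hv]; infer_instance
  have hin : ∀ i, Measure.pi (fun j => gaussianReal (a i j) v) =
      (Measure.pi fun _ : Fin m => gaussianReal 0 v).withDensity
        fun y => ∏ j, ENNReal.ofReal (Real.exp (gaussianLLR v (a i j) (y j))) := fun i => by
    have := hsf i
    simp_rw [fun j => gaussianReal_eq_withDensity (a i j) hv]
    exact pi_withDensity (hm i)
  have : ∀ i, SigmaFinite ((Measure.pi fun _ : Fin m => gaussianReal 0 v).withDensity
        fun y => ∏ j, ENNReal.ofReal (Real.exp (gaussianLLR v (a i j) (y j)))) := fun i => by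
    rw [← hin i]; infer_instance
  have hout : Measure.pi (fun i => Measure.pi fun j => gaussianReal (a i j) v) =
      (Measure.pi fun _ : Fin n => Measure.pi fun _ : Fin m => gaussianReal 0 v).withDensity
        fun y => ∏ i, ∏ j, ENNReal.ofReal (Real.exp (gaussianLLR v (a i j) (y i j))) := by
    simp_rw [hin]
    exact pi_withDensity (X := fun _ : Fin n => Fin m → ℝ)
      (f := fun i y => ∏ j, ENNReal.ofReal (Real.exp (gaussianLLR v (a i j) (y j))))
      fun i => Finset.measurable_fun_prod _ fun j _ => (hm i j).comp (measurable_pi_apply j)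
  have hmap : (Measure.pi fun _ : Fin n => Measure.pi fun _ : Fin m => gaussianReal 0 v).map
      (fun e i j => a i j + e i j) =
        Measure.pi (fun i => Measure.pi fun j => gaussianReal (a i j) v) := by
    have h1 : ∀ i, (Measure.pi fun _ : Fin m => gaussianReal 0 v).map (fun e j => a i j + e j) =
        Measure.pi fun j => gaussianReal (a i j) v := fun i => by
      have hj : ∀ j, (gaussianReal 0 v).map (fun y => a i j + y) = gaussianReal (a i j) v :=
        fun j => by rw [gaussianReal_map_const_add, zero_add]
      have : ∀ j, SigmaFinite ((gaussianReal 0 v).map fun y => a i j + y) := fun j => by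
        rw [hj]; infer_instance
      rw [Measure.pi_map_pi (f := fun j y => a i j + y) fun j => by fun_prop]
      simp_rw [hj]
    have : ∀ i, SigmaFinite ((Measure.pi fun _ : Fin m => gaussianReal 0 v).map
        fun e j => a i j + e j) := fun i => by
      rw [h1]; infer_instance
    rw [Measure.pi_map_pi (f := fun i (e : Fin m → ℝ) j => a i j + e j) fun i =>
      (measurable_pi_lambda _ fun j => (measurable_pi_apply j).const_add _).aemeasurable]
    simp_rw [h1]
  have hmm : Measurable fun y : Fin n → Fin m → ℝ =>
      ∏ i, ∏ j, ENNReal.ofReal (Real.exp (gaussianLLR v (a i j) (y i j))) :=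
    Finset.measurable_fun_prod _ fun i _ => Finset.measurable_fun_prod _ fun j _ =>
      (hm i j).comp ((measurable_pi_apply j).comp (measurable_pi_apply i))
  rw [← lintegral_map (f := G) hG (by fun_prop), hmap, hout,
    lintegral_withDensity_eq_lintegral_mul _ hmm hG]
  refine lintegral_congr fun y => ?_
  rw [Pi.mul_apply, Real.exp_sum, ENNReal.ofReal_prod_of_nonneg fun _ _ => (Real.exp_pos _).le]
  simp_rw [Real.exp_sum, ENNReal.ofReal_prod_of_nonneg fun _ _ => (Real.exp_pos _).le]

theorem gaussianRegression_predictionError (μX : Measure Ω) [IsProbabilityMeasure μX] {v : ℝ≥0}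
    (hv : v ≠ 0) {f : Ω → ℝ} (hf : Measurable f)
    {T : (Fin n → Fin m → Ω × ℝ) → Ω → ℝ} (hT : Measurable (Function.uncurry T)) :
    (gaussianRegression v f).predictionError μX n m T =
      ∫⁻ w : (Fin n → Fin m → Ω) × (Fin n → Fin m → ℝ),
        ENNReal.ofReal (Real.exp (∑ i, ∑ j, gaussianLLR v (f (w.1 i j)) (w.2 i j))) *
          ∫⁻ x, ENNReal.ofReal ((T (fun i j => (w.1 i j, w.2 i j)) x - f x) ^ 2) ∂μX
        ∂((Measure.pi fun _ : Fin n => Measure.pi fun _ : Fin m => μX).prod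
          (Measure.pi fun _ : Fin n => Measure.pi fun _ : Fin m => gaussianReal 0 v)) := by
  let R : (Fin n → Fin m → Ω) × (Fin n → Fin m → ℝ) → ℝ≥0∞ := fun w =>
    ∫⁻ x, ENNReal.ofReal ((T (fun i j => (w.1 i j, w.2 i j)) x - f x) ^ 2) ∂μX
  have hR : Measurable R := by
    have h1 : Measurable fun p : ((Fin n → Fin m → Ω) × (Fin n → Fin m → ℝ)) × Ω =>
        ((fun i j => (p.1.1 i j, p.1.2 i j) : Fin n → Fin m → Ω × ℝ), p.2) := by fun_prop
    have h2 : Measurable fun p : ((Fin n → Fin m → Ω) × (Fin n → Fin m → ℝ)) × Ω =>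
        ENNReal.ofReal ((T (fun i j => (p.1.1 i j, p.1.2 i j)) p.2 - f p.2) ^ 2) :=
      (((hT.comp h1).sub (hf.comp measurable_snd)).pow_const 2).ennreal_ofReal
    exact h2.lintegral_prod_right'
  have hu : Measurable fun w : (Fin n → Fin m → Ω) × (Fin n → Fin m → ℝ) =>
      ENNReal.ofReal (Real.exp (∑ i, ∑ j, gaussianLLR v (f (w.1 i j)) (w.2 i j))) := by
    fun_prop
  have hshift : Measurable fun w : (Fin n → Fin m → Ω) × (Fin n → Fin m → ℝ) =>
      R (w.1, fun i j => f (w.1 i j) + w.2 i j) := hR.comp (by fun_prop)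
  have hprod : Measurable fun w : (Fin n → Fin m → Ω) × (Fin n → Fin m → ℝ) =>
      ENNReal.ofReal (Real.exp (∑ i, ∑ j, gaussianLLR v (f (w.1 i j)) (w.2 i j))) *
        ∫⁻ x, ENNReal.ofReal ((T (fun i j => (w.1 i j, w.2 i j)) x - f x) ^ 2) ∂μX := hu.mul hR
  rw [predictionError, gaussianRegression_mean]
  change ∫⁻ w : (Fin n → Unit) × (Fin n → Fin m → Ω) × (Fin n → Fin m → ℝ),
    R (w.2.1, fun i j => f (w.2.1 i j) + w.2.2 i j) ∂((Measure.pi fun _ : Fin n => Measure.dirac ()).prod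
      ((Measure.pi fun _ : Fin n => Measure.pi fun _ : Fin m => μX).prod
      (Measure.pi fun _ : Fin n => Measure.pi fun _ : Fin m => gaussianReal 0 v))) = _
  rw [measurePreserving_snd.lintegral_comp hshift, lintegral_prod _ hshift.aemeasurable, lintegral_prod _ hprod.aemeasurable]
  exact lintegral_congr fun X =>
    lintegral_shift_gaussian hv (fun i j => f (X i j)) (hR.comp measurable_prodMk_left)

/-- Assouad's lemma in the Gaussian regression model with `n * m` observations. -/
theorem exists_le_predictionError_gaussianRegression {κ : Type*} [Fintype κ] [DecidableEq κ]
    {μX : Measure Ω} [IsProbabilityMeasure μX] {v : ℝ≥0} (hv : v ≠ 0)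
    {f : (κ → Bool) → Ω → ℝ} (hf : ∀ θ, Measurable (f θ))
    {A : κ → Set Ω} (hA : ∀ k, MeasurableSet (A k)) (hdisj : Pairwise (Function.onFun Disjoint A))
    {Δ : ℝ} (hΔ : 0 ≤ Δ)
    (hsep : ∀ θ k, ∀ x ∈ A k, Δ ≤ |f (Function.update θ k !θ k) x - f θ x|)
    (hclose : ∀ θ k, ∫⁻ x, ENNReal.ofReal
        (Real.exp ((f (Function.update θ k !θ k) x - f θ x) ^ 2 / v)) ∂μX ≤
      ENNReal.ofReal (Real.exp (1 / (2 * (n * m)))))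
    (hnm : 0 < n * m)
    {T : (Fin n → Fin m → Ω × ℝ) → Ω → ℝ} (hT : Measurable (Function.uncurry T)) :
    ∃ θ, ENNReal.ofReal (Δ ^ 2 / 8) * μX (⋃ k, A k) ≤
      (gaussianRegression v (f θ)).predictionError μX n m T := by
  have hum : ∀ θ, Measurable fun w : (Fin n → Fin m → Ω) × (Fin n → Fin m → ℝ) =>
      ∑ i, ∑ j, gaussianLLR v (f θ (w.1 i j)) (w.2 i j) := fun θ => by
    have := hf θ
    fun_prop
  obtain ⟨θ, hθ⟩ := exists_le_squared_error (κ := κ) (μ := μX)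
    (ρ := (Measure.pi fun _ : Fin n => Measure.pi fun _ : Fin m => μX).prod
          (Measure.pi fun _ : Fin n => Measure.pi fun _ : Fin m => gaussianReal 0 v))
    (L := fun θ w => ENNReal.ofReal
      (Real.exp (∑ i, ∑ j, gaussianLLR v (f θ (w.1 i j)) (w.2 i j))))
    (fun θ => (hum θ).exp.ennreal_ofReal) hf hA hdisj hΔ hsep
    (fun θ k => by
      refine one_half_le_lintegral_min (hum _) (hum _) ?_ ?_
      · rw [lintegral_prod _ (hum _).exp.ennreal_ofReal.aemeasurable]
        simp only
        simp_rw [fun X : Fin n → Fin m → Ω => lintegral_pi_pi_exp_sum (gaussianReal 0 v)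
          (q := fun i j => gaussianLLR v (f (Function.update θ k !θ k) (X i j)))
          (fun i j => by fun_prop), lintegral_exp_gaussianLLR _ hv]
        simp
      · have hm2 : Measurable fun w : (Fin n → Fin m → Ω) × (Fin n → Fin m → ℝ) =>
            ENNReal.ofReal (Real.exp (2 * ∑ i, ∑ j,
              gaussianLLR v (f (Function.update θ k !θ k) (w.1 i j)) (w.2 i j) -
                ∑ i, ∑ j, gaussianLLR v (f θ (w.1 i j)) (w.2 i j))) :=
          (((hum _).const_mul 2).sub (hum _)).exp.ennreal_ofReal
        rw [lintegral_prod _ hm2.aemeasurable]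
        simp_rw [Finset.mul_sum, ← Finset.sum_sub_distrib]
        simp_rw [fun X : Fin n → Fin m → Ω => lintegral_pi_pi_exp_sum (gaussianReal 0 v)
          (q := fun i j y => 2 * gaussianLLR v (f (Function.update θ k !θ k) (X i j)) y -
            gaussianLLR v (f θ (X i j)) y)
          (fun i j => by fun_prop),
          lintegral_exp_two_mul_gaussianLLR_sub _ _ hv,
          ← ENNReal.ofReal_prod_of_nonneg fun (_ : Fin m) _ => (Real.exp_pos _).le,
          ← Real.exp_sum,
          ← ENNReal.ofReal_prod_of_nonneg fun (_ : Fin n) _ => (Real.exp_pos _).le,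
          ← Real.exp_sum]
        -- After the noise is integrated out, the design points are independent and the
        -- $\chi^2$-integral is the $nm$-th power of the integral in `hclose`, hence at most
        -- $e^{1/2}\le2$.
        have hq : Measurable fun x => (f (Function.update θ k !θ k) x - f θ x) ^ 2 / (v : ℝ) :=
          (((hf _).sub (hf _)).pow_const 2).div_const _
        rw [lintegral_pi_pi_exp_sum μX
          (q := fun _ _ x => (f (Function.update θ k !θ k) x - f θ x) ^ 2 / v) fun _ _ => hq]
        simp only [Finset.prod_const, Finset.card_univ, Fintype.card_fin]
        rw [← pow_mul]
        refine (pow_le_pow_left' (hclose θ k) _).trans ?_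
        rw [← ENNReal.ofReal_pow (Real.exp_pos _).le, ← Real.exp_nat_mul]
        refine ENNReal.ofReal_le_of_le_toReal ?_
        have h1 : ((m * n : ℕ) : ℝ) * (1 / (2 * (n * m))) = 1 / 2 := by
          have : (n : ℝ) * m ≠ 0 := by exact_mod_cast hnm.ne'
          push_cast
          rw [mul_comm (m : ℝ), mul_one_div, mul_comm (2 : ℝ), ← div_div, div_self this]
        rw [h1]
        simpa using exp_one_half_le_two)
    (T := fun w => T fun i j => (w.1 i j, w.2 i j))
    (by
      have h1 : Measurable fun p : ((Fin n → Fin m → Ω) × (Fin n → Fin m → ℝ)) × Ω =>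
        ((fun i j => (p.1.1 i j, p.1.2 i j) : Fin n → Fin m → Ω × ℝ), p.2) := by fun_prop
      exact hT.comp h1)
  exact ⟨θ, hθ.trans (gaussianRegression_predictionError μX hv (hf θ) hT).ge⟩

end RegressionModel

end RandomFunctionModel
end

noncomputable section
open scoped NNReal

/-! ### From families of functions to rates -/

section Rates

variable {d : ℕ} {Ω : Set (EuclideanSpace ℝ (Fin d))}

theorem le_minimaxError {μX : Measure Ω} {b₂ b₃ : ℝ} {F : Set (Ω → ℝ)} {n m : ℕ} {r : ℝ≥0∞}
    (h : ∀ T : (Fin n → Fin m → Ω × ℝ) → Ω → ℝ, Measurable (Function.uncurry T) →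
      ∃ 𝓜 : RandomFunctionModel Ω, 𝓜.SubExponential μX b₂ b₃ ∧ 𝓜.mean ∈ F ∧
        r ≤ 𝓜.predictionError μX n m T) : r ≤ minimaxError μX b₂ b₃ F n m := by
  refine le_iInf₂ fun T hT => ?_
  obtain ⟨𝓜, h1, h2, h3⟩ := h T hT
  exact h3.trans (le_iSup₂_of_le 𝓜 h1 (le_iSup_of_le h2 le_rfl))

theorem exists_inv_le_minimaxError {μX : Measure Ω} [IsProbabilityMeasure μX] {b₂ b₃ ε : ℝ}
    (hb₂ : 0 < b₂) {F : Set (Ω → ℝ)} (hε : 0 < ε) (hF : ∀ c : ℝ, |c| ≤ ε → (fun _ => c) ∈ F) :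
    ∃ c : ℝ, 0 < c ∧ ∀ n m : ℕ, 0 < n * m →
      ENNReal.ofReal (c * (n : ℝ)⁻¹) ≤ minimaxError μX b₂ b₃ F n m := by
  let v : ℝ≥0 := ⟨b₂ ^ 2 / 8, by positivity⟩
  have hv : 0 < v := by change (0 : ℝ) < b₂ ^ 2 / 8; positivity
  have hvr : (0 : ℝ) < v := hv
  -- With $a=\delta/\sqrt n$ the constants stay within $\varepsilon$ and $na^2=\delta^2\le v/2$.
  set δ : ℝ := min ε √(v / 2) with hδ
  have hδ0 : 0 < δ := lt_min hε (by positivity)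
  have hδ2 : δ ^ 2 ≤ v / 2 := by
    rw [← Real.sq_sqrt (show (0 : ℝ) ≤ v / 2 by positivity)]
    exact pow_le_pow_left₀ hδ0.le (min_le_right _ _) 2
  refine ⟨δ ^ 2 / 8, by positivity, fun n m hnm => le_minimaxError fun T hT => ?_⟩
  have hn : (1 : ℝ) ≤ n := by exact_mod_cast Nat.pos_of_mul_pos_right hnm
  have hsq : (δ / √n) ^ 2 = δ ^ 2 / n := by rw [div_pow, Real.sq_sqrt (by positivity)]
  obtain ⟨b, hb, hle⟩ := RandomFunctionModel.exists_le_predictionError_gaussianConstant (μX := μX)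
    hv.ne' (a := δ / √n) (by positivity) (by rw [hsq]; field_simp; linarith) hT
  refine ⟨_, RandomFunctionModel.gaussianConstant_subExponential (v := v) hb₂ le_rfl b, ?_, ?_⟩
  · rw [funext (RandomFunctionModel.gaussianConstant_mean v b)]
    refine hF b (hb.trans ((div_le_self hδ0.le ?_).trans (min_le_left _ _)))
    rwa [Real.one_le_sqrt]
  · rw [hsq] at hle
    convert hle using 2
    field_simp

/-- Multiply $1-u\le e^{-u}$ by $e^u$. This linearization makes the $\chi^2$-integral exceed one
only by the squared change times the mass where it occurs. -/
theorem exp_le_one_add_mul_exp {u B : ℝ} (h0 : 0 ≤ u) (hB : u ≤ B) :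
    Real.exp u ≤ 1 + u * Real.exp B := by
  have h1 := Real.add_one_le_exp (-u)
  have h2 : Real.exp (-u) * Real.exp u = 1 := by rw [← Real.exp_add]; simp
  have h3 := mul_le_mul_of_nonneg_right h1 (Real.exp_pos u).le
  have h4 := mul_le_mul_of_nonneg_left (Real.exp_le_exp.2 hB) h0
  nlinarith

/-- The class `F` contains, at each scale `h ∈ (0, 1]`, a family of functions indexed by bits: each
bit changes the function by `H * h ^ σ` on a set `A k`, at most by that much elsewhere, and not at
all outside of a set of mass at most `V * h ^ K`, and the sets `A k` are disjoint with total mass at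
least `w`. -/
def HasBitFamilies (μX : Measure Ω) (F : Set (Ω → ℝ)) (σ : ℝ) (K : ℕ) (H V w : ℝ) : Prop :=
  ∀ h : ℝ, 0 < h → h ≤ 1 → ∃ (N : ℕ) (f : ((Fin K → Fin N) → Bool) → Ω → ℝ)
    (A B : (Fin K → Fin N) → Set Ω),
    (∀ θ, f θ ∈ F ∧ Measurable (f θ)) ∧ (∀ k, MeasurableSet (A k) ∧ MeasurableSet (B k)) ∧
    Pairwise (Function.onFun Disjoint A) ∧
    (∀ θ k, ∀ x ∈ A k, H * h ^ σ ≤ |f (Function.update θ k !θ k) x - f θ x|) ∧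
    (∀ θ k x, |f (Function.update θ k !θ k) x - f θ x| ≤ H * h ^ σ) ∧
    (∀ θ k, ∀ x ∉ B k, f (Function.update θ k !θ k) x = f θ x) ∧
    (∀ k, μX (B k) ≤ ENNReal.ofReal (V * h ^ K)) ∧
    ENNReal.ofReal w ≤ μX (⋃ k, A k)

theorem HasBitFamilies.exists_rpow_le_minimaxError {μX : Measure Ω} [IsProbabilityMeasure μX]
    {b₂ b₃ : ℝ} (hb₃ : 0 < b₃) {F : Set (Ω → ℝ)} {σ H V w : ℝ} {K : ℕ} (hσ : 0 < σ) (hK : 0 < K)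
    (hH : 0 < H) (hH1 : H ≤ 1) (hV : 0 < V) (hw : 0 < w) (hF : HasBitFamilies μX F σ K H V w) :
    ∃ c : ℝ, 0 < c ∧ ∀ n m : ℕ, 0 < n * m →
      ENNReal.ofReal (c * ((n : ℝ) * m) ^ (-(2 * σ) / (2 * σ + K))) ≤
        minimaxError μX b₂ b₃ F n m := by
  let v : ℝ≥0 := ⟨b₃ ^ 2 / 8, by positivity⟩
  have hv : 0 < v := by change (0 : ℝ) < b₃ ^ 2 / 8; positivity
  have hvr : (0 : ℝ) < v := hv
  have hK' : (0 : ℝ) < K := by exact_mod_cast hK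
  set D : ℝ := Real.exp (1 / v) / v with hD
  have hD0 : 0 < D := by positivity
  -- The first entry ensures $h\le1$; the second gives $DV\,h^{2\sigma+K}\le1/(2nm)$, which is what
  -- the overlap condition asks for.
  set c₁ : ℝ := min 1 (1 / (2 * D * V)) with hc₁
  have hc₁0 : 0 < c₁ := lt_min one_pos (by positivity)
  refine ⟨H ^ 2 / 8 * w * c₁ ^ (2 * σ / (2 * σ + K)), by positivity,
    fun n m hnm => le_minimaxError fun T hT => ?_⟩
  have hnm1 : (1 : ℝ) ≤ (n : ℝ) * m := by exact_mod_cast hnm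
  have hnm0 : (0 : ℝ) < (n : ℝ) * m := by linarith
  set h : ℝ := (c₁ / (n * m)) ^ (1 / (2 * σ + K)) with hh
  have hb0 : 0 < c₁ / (n * m) := by positivity
  have hb1 : c₁ / (n * m) ≤ 1 := by
    rw [div_le_one hnm0]
    exact (min_le_left _ _).trans hnm1
  have h0 : 0 < h := Real.rpow_pos_of_pos hb0 _
  have h1 : h ≤ 1 := Real.rpow_le_one hb0.le hb1 (by positivity)
  have hpow : (h ^ σ) ^ 2 * h ^ K = c₁ / (n * m) := by
    rw [← Real.rpow_mul_natCast h0.le, ← Real.rpow_natCast h K, ← Real.rpow_add h0, hh,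
      ← Real.rpow_mul hb0.le]
    rw [show 1 / (2 * σ + K) * (σ * (2 : ℕ) + K) = 1 by push_cast; field_simp, Real.rpow_one]
  have hpow2 : (h ^ σ) ^ 2 =
      c₁ ^ (2 * σ / (2 * σ + K)) * ((n : ℝ) * m) ^ (-(2 * σ) / (2 * σ + K)) := by
    rw [← Real.rpow_mul_natCast h0.le, hh, ← Real.rpow_mul hb0.le, neg_div, Real.rpow_neg hnm0.le,
      ← div_eq_mul_inv, ← Real.div_rpow hc₁0.le hnm0.le]
    congr 1
    push_cast
    field_simp
  have hσ1 : H * h ^ σ ≤ 1 := mul_le_one₀ hH1 (by positivity) (Real.rpow_le_one h0.le h1 hσ.le)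
  obtain ⟨N, f, A, B, hf, hAB, hdisj, hsep, hle, hoff, hB, hA⟩ := hF h h0 h1
  have hexp : ∀ θ k x, ENNReal.ofReal (Real.exp ((f (Function.update θ k !θ k) x - f θ x) ^ 2 / v)) ≤
      1 + (B k).indicator (fun _ => ENNReal.ofReal ((h ^ σ) ^ 2 * D)) x := by
    intro θ k x
    by_cases hx : x ∈ B k
    · rw [Set.indicator_of_mem hx, ← ENNReal.ofReal_one, ← ENNReal.ofReal_add one_pos.le
        (by positivity)]
      apply ENNReal.ofReal_le_ofReal
      have e1 : (f (Function.update θ k !θ k) x - f θ x) ^ 2 ≤ (H * h ^ σ) ^ 2 := by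
        rw [← sq_abs]
        exact pow_le_pow_left₀ (abs_nonneg _) (hle θ k x) 2
      have e2 : (H * h ^ σ) ^ 2 ≤ (h ^ σ) ^ 2 :=
        pow_le_pow_left₀ (by positivity) (mul_le_of_le_one_left (by positivity) hH1) 2
      have e3 : (H * h ^ σ) ^ 2 ≤ 1 := pow_le_one₀ (by positivity) hσ1
      refine (exp_le_one_add_mul_exp (B := 1 / v) (by positivity) ?_).trans ?_
      · gcongr
        exact e1.trans e3
      · rw [hD, mul_div_assoc', div_mul_eq_mul_div]
        have := div_le_div_of_nonneg_right
          (mul_le_mul_of_nonneg_right (e1.trans e2) (Real.exp_pos (1 / (v : ℝ))).le) hvr.le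
        linarith
    · rw [hoff θ k x hx, Set.indicator_of_notMem hx]
      simp
  obtain ⟨θ, hθ⟩ := RandomFunctionModel.exists_le_predictionError_gaussianRegression (μX := μX)
    hv.ne' (fun θ => (hf θ).2) (fun k => (hAB k).1) hdisj (Δ := H * h ^ σ) (by positivity) hsep
    (fun θ k => by
      refine (lintegral_mono (hexp θ k)).trans ?_
      rw [lintegral_add_left measurable_const, lintegral_indicator_const (hAB k).2,
        lintegral_const, measure_univ, mul_one]
      calc 1 + ENNReal.ofReal ((h ^ σ) ^ 2 * D) * μX (B k)
          ≤ 1 + ENNReal.ofReal ((h ^ σ) ^ 2 * D) * ENNReal.ofReal (V * h ^ K) := by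
            gcongr
            exact hB k
        _ = ENNReal.ofReal (1 + D * V * ((h ^ σ) ^ 2 * h ^ K)) := by
            rw [← ENNReal.ofReal_mul (by positivity), ← ENNReal.ofReal_one,
              ← ENNReal.ofReal_add one_pos.le (by positivity)]
            congr 1
            ring
        _ ≤ ENNReal.ofReal (Real.exp (1 / (2 * (n * m)))) := by
            apply ENNReal.ofReal_le_ofReal
            rw [hpow, add_comm]
            refine (Real.add_one_le_exp _).trans (Real.exp_le_exp.2 ?_)
            have := min_le_right 1 (1 / (2 * D * V))
            rw [← hc₁, le_div_iff₀ (by positivity)] at this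
            rw [mul_div_assoc', div_le_div_iff₀ hnm0 (by positivity)]
            nlinarith)
    hnm hT
  refine ⟨_, RandomFunctionModel.gaussianRegression_subExponential (v := v) hb₃ le_rfl (f θ), ?_, ?_⟩
  · rw [RandomFunctionModel.gaussianRegression_mean]
    exact (hf θ).1
  · refine le_trans ?_ hθ
    calc ENNReal.ofReal (H ^ 2 / 8 * w * c₁ ^ (2 * σ / (2 * σ + K)) *
          ((n : ℝ) * m) ^ (-(2 * σ) / (2 * σ + K)))
        = ENNReal.ofReal ((H * h ^ σ) ^ 2 / 8) * ENNReal.ofReal w := by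
          rw [← ENNReal.ofReal_mul (by positivity), mul_pow, hpow2]
          congr 1
          ring
      _ ≤ _ := by gcongr

end Rates

/-! ### Bit families in the hierarchical class -/

namespace SDTree

variable {d : ℕ} {Ω : Set (EuclideanSpace ℝ (Fin d))} {M : ℝ}

/-- Bump fields at scale $h$ in $K_G$ distinct coordinates are placed at $G$ and lifted to the tree.
No smoothness of the lifted function is used: it lies in the class by construction. -/
theorem Node.exists_hasBitFamilies (hΩ : ∀ x ∈ Ω, ∀ i, x i ∈ Set.Icc (0 : ℝ) 1)
    (hΩm : MeasurableSet Ω) (hpos : volume Ω ≠ 0) (hM : 0 < M) {t : SDTree} (G : t.Node)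
    (ht : t.Admissible) (hGd : G.dim ≤ d) :
    ∃ H V w : ℝ, 0 < H ∧ H ≤ 1 ∧ 0 < V ∧ 0 < w ∧
      HasBitFamilies (uniformLaw Ω) (t.hierarchicalClass M Ω) G.effectiveSmoothness G.dim H V w := by
  have := isProbabilityMeasure_uniformLaw hΩ hΩm hpos
  have hvol := volume_lt_top_of_subset_cube hΩ
  obtain ⟨hs, hK, hA⟩ := G.pos_of_admissible ht
  obtain ⟨F, c, a, hc0, hc1, hF, ha, hmem⟩ := G.exists_lift hΩ hM ht
  obtain ⟨C, hC⟩ := exists_hasDerivBounds_bumpField G.dim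
  obtain ⟨ε', hε', hball⟩ := exists_scale_mem_holderBall (K := G.dim) C hs hM
  obtain ⟨ε, hε0, hε1, hε⟩ : ∃ ε : ℝ, 0 < ε ∧ ε ≤ 1 ∧ |ε| ≤ ε' :=
    ⟨min ε' 1, by positivity, min_le_right _ _, by
      rw [abs_of_pos (by positivity)]; exact min_le_left _ _⟩
  generalize G.dim = K at *
  generalize hsG : G.smoothness = s at *
  generalize hAG : G.ancestorFactor = α at *
  have hvr : 0 < (volume Ω).toReal := ENNReal.toReal_pos hpos hvol.ne
  have hprod : 0 < ∏ i, (a i)⁻¹ := Finset.prod_pos fun i _ => inv_pos.2 (ha i).1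
  refine ⟨c * ε ^ α, (volume Ω).toReal⁻¹ * ∏ i, (a i)⁻¹, (2 ^ K)⁻¹, by positivity,
    mul_le_one₀ hc1 (by positivity) (Real.rpow_le_one hε0.le hε1 hA.le), by positivity,
    by positivity, fun h h0 h1 => ?_⟩
  let π : Fin K → Fin d := Fin.castLE hGd
  let z : Ω → EuclideanSpace ℝ (Fin K) := fun x => h⁻¹ • WithLp.toLp 2 fun i => a i * x.1 (π i)
  have hz : Measurable z := by
    have : Continuous z := by fun_prop
    exact this.measurable
  have hzi : ∀ x i, z x i = h⁻¹ * (a i * x.1 (π i)) := fun x i => rfl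
  -- Rescaled coordinates reach up to $h^{-1}$; the half shift and a strict inequality must fit as
  -- well.
  let N : ℕ := ⌈h⁻¹ + 1 / 2⌉₊ + 1
  -- Pigeonhole: the plateaus of the $2^K$ translated grids cover $\Omega$, so one grid carries its
  -- share of the mass.
  let shift : (Fin K → Bool) → Fin K → ℝ := fun b i => if b i then 1 / 2 else 0
  obtain ⟨b, hb⟩ : ∃ b, ENNReal.ofReal (2 ^ K)⁻¹ ≤
      uniformLaw Ω (⋃ k : Fin K → Fin N, z ⁻¹' innerCell (1 / 4) (shift b) k) := by
    by_contra! hcon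
    have hcov : (Set.univ : Set Ω) ⊆
        ⋃ b, ⋃ k : Fin K → Fin N, z ⁻¹' innerCell (1 / 4) (shift b) k := fun x _ => by
      obtain ⟨b, k, hk⟩ := exists_mem_innerCell (N := N) (z := z x)
        (fun i => by
          have := (hΩ x.1 x.2 (π i)).1
          have := (ha i).1
          rw [hzi]; positivity)
        (fun i => by
          have h2 := hΩ x.1 x.2 (π i)
          have h3 : a i * x.1 (π i) ≤ 1 := mul_le_one₀ (ha i).2 h2.1 h2.2
          have h4 : h⁻¹ * (a i * x.1 (π i)) ≤ h⁻¹ := mul_le_of_le_one_right (by positivity) h3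
          have h5 := Nat.le_ceil (h⁻¹ + 1 / 2)
          rw [hzi]
          simp only [N]
          push_cast
          linarith)
      exact Set.mem_iUnion₂.2 ⟨b, k, hk⟩
    have h2 := (measure_mono hcov).trans (measure_iUnion_le (μ := uniformLaw Ω) _)
    rw [measure_univ, tsum_fintype] at h2
    have h3 := ENNReal.sum_lt_sum_of_nonempty (s := (Finset.univ : Finset (Fin K → Bool)))
      Finset.univ_nonempty fun b _ => hcon b
    refine absurd (h2.trans_lt h3) (not_lt.2 (le_of_eq ?_))
    rw [Finset.sum_const, Finset.card_univ, nsmul_eq_mul, Fintype.card_fun, Fintype.card_bool,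
      Fintype.card_fin, ENNReal.ofReal_inv_of_pos (by positivity)]
    push_cast
    rw [ENNReal.ofReal_pow two_pos.le, ENNReal.ofReal_ofNat]
    exact ENNReal.mul_inv_cancel (by positivity) (by finiteness)
  -- The argument of $F$ stays in $[0,1]$, so the power factors and the amplitude becomes
  -- $h^{s\alpha}$.
  have hval : ∀ θ : (Fin K → Fin N) → Bool, ∀ x : Ω,
      F (ε * h ^ s * bumpField (shift b) θ (z x)) =
        c * ε ^ α * h ^ (s * α) * bumpField (shift b) θ (z x) ^ α := fun θ x => by
    have hβ := bumpField_mem_Icc (shift b) θ (z x)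
    have hh : h ^ s ≤ 1 := Real.rpow_le_one h0.le h1 hs.le
    have hh0 : 0 ≤ h ^ s := by positivity
    have h2 : ε * h ^ s ≤ 1 := mul_le_one₀ hε1 hh0 hh
    rw [hF _ (mul_nonneg (by positivity) hβ.1) (mul_le_one₀ h2 hβ.1 hβ.2),
      Real.mul_rpow (by positivity) hβ.1, Real.mul_rpow hε0.le hh0, ← Real.rpow_mul h0.le]
    ring
  have hHpos : 0 < c * ε ^ α * h ^ (s * α) := by positivity
  have heff : G.effectiveSmoothness = s * α := by rw [Node.effectiveSmoothness, hsG, hAG]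
  rw [heff]
  refine ⟨N, fun θ x => F (ε * h ^ s * bumpField (shift b) θ (z x)),
    fun k => z ⁻¹' innerCell (1 / 4) (shift b) k, fun k => z ⁻¹' innerCell (1 / 8) (shift b) k,
    fun θ => ⟨hmem _ (hball _ (hC N (shift b) θ) ε hε h h0 h1) π, ?_⟩,
    fun k => ⟨hz (isClosed_innerCell _ _ k).measurableSet, hz (isClosed_innerCell _ _ k).measurableSet⟩,
    fun k l hkl => (pairwise_disjoint_innerCell (by norm_num) _ hkl).preimage z,
    fun θ k x hx => ?_, fun θ k x => ?_, fun θ k x hx => ?_, fun k => ?_, hb⟩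
  · simp_rw [hval]
    have : Measurable fun x => bumpField (shift b) θ (z x) :=
      (hC N (shift b) θ).contDiff.continuous.measurable.comp hz
    fun_prop
  · simp only [hval]
    rw [bumpField_eq_of_mem_quarter _ _ hx, bumpField_eq_of_mem_quarter _ _ hx]
    -- On a plateau the bump field is exactly $0$ or $1$, values fixed by the power $\alpha>0$; the
    -- separation loses nothing.
    cases hθ : θ k <;> simp [Real.zero_rpow hA.ne', abs_of_pos hHpos]
  · simp only [hval]
    rw [← mul_sub, abs_mul, abs_of_pos hHpos]
    refine mul_le_of_le_one_right hHpos.le ?_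
    have hβ : ∀ θ : (Fin K → Fin N) → Bool, bumpField (shift b) θ (z x) ^ α ∈ Set.Icc (0 : ℝ) 1 :=
      fun θ => by
        have := bumpField_mem_Icc (shift b) θ (z x)
        exact ⟨Real.rpow_nonneg this.1 _, Real.rpow_le_one this.1 this.2 hA.le⟩
    rw [abs_le]
    constructor <;> linarith [(hβ θ).1, (hβ θ).2, (hβ (Function.update θ k !θ k)).1,
      (hβ (Function.update θ k !θ k)).2]
  · simp only
    rw [bumpField_update_of_notMem _ _ _ hx]
  -- Undoing the scaling turns the cell into a box with sides $\tfrac34h/a_i$.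
  · have hset : z ⁻¹' innerCell (1 / 8) (shift b) k ⊆ Subtype.val ⁻¹' {x : EuclideanSpace ℝ (Fin d) |
        ∀ i, x (π i) ∈ Set.Icc (h * (a i)⁻¹ * (1 / 8 - (shift b i - k i)))
          (h * (a i)⁻¹ * (1 - 1 / 8 - (shift b i - k i)))} := by
      intro x hx i
      have hxi := hx i
      rw [hzi] at hxi
      have ha0 := (ha i).1
      have e : x.1 (π i) = h * (a i)⁻¹ * (h⁻¹ * (a i * x.1 (π i))) := by field_simp
      rw [e]
      constructor
      · gcongr; linarith [hxi.1]
      · gcongr; linarith [hxi.2]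
    refine (measure_mono hset).trans ?_
    rw [uniformLaw_apply hΩm]
    have hbox := volume_box_le hΩ (Fin.castLE_injective hGd)
      (fun i => h * (a i)⁻¹ * (1 / 8 - (shift b i - k i)))
      (fun i => h * (a i)⁻¹ * (1 - 1 / 8 - (shift b i - k i)))
    calc _ ≤ (volume Ω)⁻¹ * ∏ i, ENNReal.ofReal (h * (a i)⁻¹ * (1 - 1 / 8 - (shift b i - k i)) -
            h * (a i)⁻¹ * (1 / 8 - (shift b i - k i))) := by
          gcongr
          exact hbox
      _ ≤ (volume Ω)⁻¹ * ∏ i, ENNReal.ofReal (h * (a i)⁻¹) := by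
          gcongr with i _
          have : 0 < h * (a i)⁻¹ := mul_pos h0 (inv_pos.2 (ha i).1)
          linarith
      _ = _ := by
          rw [← ENNReal.ofReal_prod_of_nonneg fun i _ => (mul_pos h0 (inv_pos.2 (ha i).1)).le,
            Finset.prod_mul_distrib, Finset.prod_const, Finset.card_univ, Fintype.card_fin,
            mul_assoc, ENNReal.ofReal_mul (p := (volume Ω).toReal⁻¹) (by positivity),
            ENNReal.ofReal_inv_of_pos hvr, ENNReal.ofReal_toReal hvol.ne, mul_comm (h ^ K)]

end SDTree
end

/-! ### The two rates combined -/

theorem theorem6 {d : ℕ} (Ω : Set (EuclideanSpace ℝ (Fin d)))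
    (hΩ_cube : ∀ x ∈ Ω, ∀ i, x i ∈ Set.Icc (0 : ℝ) 1)
    (hΩ_meas : MeasurableSet Ω) (hΩ_pos : volume Ω ≠ 0)
    (𝒢 : SDTree) (h𝒢 : 𝒢.Admissible)
    (M b₂ b₃ : ℝ) (hM : 0 < M) (hb₂ : 0 < b₂) (hb₃ : 0 < b₃)
    (hG : ∃ G : 𝒢.Node, G.effectiveSmoothness / G.dim = 𝒢.intrinsicRatio ∧ G.dim ≤ d) :
    ∃ c : ℝ, 0 < c ∧ ∀ n m : ℕ, 3 ≤ n * m →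
      ENNReal.ofReal (c * ((n : ℝ)⁻¹ +
          ((n : ℝ) * m) ^ (-(2 * 𝒢.intrinsicRatio) / (2 * 𝒢.intrinsicRatio + 1))))
        ≤ minimaxError (uniformLaw Ω) b₂ b₃ (𝒢.hierarchicalClass M Ω) n m := by
  obtain ⟨G, hγ, hGd⟩ := hG
  have := isProbabilityMeasure_uniformLaw hΩ_cube hΩ_meas hΩ_pos
  obtain ⟨hs, hK, hA⟩ := G.pos_of_admissible h𝒢
  have hσ : 0 < G.effectiveSmoothness := mul_pos hs hA
  have hK' : (0 : ℝ) < G.dim := by exact_mod_cast hK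
  obtain ⟨ε, hε, hconst⟩ := SDTree.exists_const_mem hΩ_cube hM (by omega) 𝒢 h𝒢
  obtain ⟨c₁, hc₁, h₁⟩ := exists_inv_le_minimaxError (μX := uniformLaw Ω) (b₃ := b₃) hb₂ hε hconst
  obtain ⟨H, V, w, hH, hH1, hV, hw, hfam⟩ :=
    G.exists_hasBitFamilies hΩ_cube hΩ_meas hΩ_pos hM h𝒢 hGd
  obtain ⟨c₂, hc₂, h₂⟩ :=
    hfam.exists_rpow_le_minimaxError (b₂ := b₂) hb₃ hσ (by omega) hH hH1 hV hw
  -- Divide numerator and denominator by $K_G$.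
  have hexp : -(2 * G.effectiveSmoothness) / (2 * G.effectiveSmoothness + G.dim) =
      -(2 * 𝒢.intrinsicRatio) / (2 * 𝒢.intrinsicRatio + 1) := by
    rw [← hγ]
    field_simp
  refine ⟨min c₁ c₂ / 2, by positivity, fun n m hnm => ?_⟩
  have e₁ := h₁ n m (by omega)
  have e₂ := h₂ n m (by omega)
  rw [hexp] at e₂
  set r := ((n : ℝ) * m) ^ (-(2 * 𝒢.intrinsicRatio) / (2 * 𝒢.intrinsicRatio + 1)) with hr
  have hr0 : 0 ≤ r := by positivity
  have hn0 : 0 ≤ (n : ℝ)⁻¹ := by positivity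
  -- Half of the sum is at most the maximum; this is why the constant is halved.
  refine (ENNReal.ofReal_le_ofReal ?_).trans (max_le e₁ e₂ |>.trans' (le_of_eq
    (Monotone.map_max fun _ _ h => ENNReal.ofReal_le_ofReal h)))
  have f₁ : min c₁ c₂ * (n : ℝ)⁻¹ ≤ c₁ * (n : ℝ)⁻¹ := by gcongr; exact min_le_left _ _
  have f₂ : min c₁ c₂ * r ≤ c₂ * r := by gcongr; exact min_le_right _ _
  have g₁ := le_max_left (c₁ * (n : ℝ)⁻¹) (c₂ * r)
  have g₂ := le_max_right (c₁ * (n : ℝ)⁻¹) (c₂ * r)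
  linarith
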